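/- **Conventions.** Let $\sigma(x)_k=x_{k+1}$ be the shift on $\{0,\dots,n-1\}^{\mathbb Z}$. A shift space $X\subseteq\{0,\dots,n-1\}^{\mathbb Z}$ (a set with $\sigma X\subseteq X$) carries the product topology and the metric $d(x,y)=\sum_{k\in\mathbb Z}|x_k-y_k|\,n^{-|k|-1}$; $\dim X$ is its Hausdorff dimension for $d$. Its topological entropy is $h(X)=\lim_k\frac1k\log\Gamma_k(X)$, where $\Gamma_k(X)$ is the number of words of length $k$ occurring in $X$; the entropy of a $\sigma$-invariant Borel probability measure $\mu$ on $X$ is $h_\mu(X)=-\lim_k\frac1k\sum_I\mu(I)\log\mu(I)$, the sum over the cylinders of length $k$; $\mathcal M_{\max}(X)$, with the weak topology, is the set of such $\mu$ with $h_\mu(X)=h(X)$. A factor map $f$ is a continuous shift-commuting surjection, $f\mu=\mu\circ f^{-1}$; it is finite-to-one if every point has finitely many preimages, uniform if $f\mu\in\mathcal M_{\max}(Y)$ for every $\mu\in\mathcal M_{\max}(X)$, and a factor map $f:X\to Y$ has a synchronizing word if there are a nonempty word $w_0\cdots w_k$ of $Y$ and a symbol $a$ such that $x_k=a$ for all $x\in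 X$ with $f(x)_0\cdots f(x)_k=w_0\cdots w_k$. Let $\mathcal B$ be a set of local patterns in $\{-1,1\}^{(2d+1)\times 2}$, for instance the basic set of admissible local patterns of a two-layer cellular neural network. The solution space $\mathbf Y$ is the set of pairs $(y^{(1)},y^{(2)})$ of sequences in $\{-1,1\}^{\mathbb Z}$ whose restriction to $\{k-d,\dots,k+d\}$ belongs to $\mathcal B$ for every $k\in\mathbb Z$, and the hidden space $\mathbf Y^{(1)}$ and the output space $\mathbf Y^{(2)}$ are the projections of $\mathbf Y$ to $y^{(1)}$ and $y^{(2)}$. In the metric the symbols $-1,1$ are coded as $0,1$, and $n_1=n_2=2$ is the number of symbols. For $i=1,2$ let $W^{(i)}=\{x: T^{(i)}(x_k,x_{k+1})=1\ \forall k\in\mathbb Z\}$ be the topological Markov chain of an irreducible $0$-$1$ matrix $T^{(i)}$ of size $m_i\ge1$, and let $\phi^{(i)}:W^{(i)}\to\mathbf Y^{(i)}$ be a finite-to-one factor map. For a shift space $X$ over $n$ symbols, $\kappa>0$ and an invariant probability measure $\mu$ on $X$, let $D_\kappa(X,\mu)$ be the formula $$\dim X=\kappa\,\frac{h_\mu(X)}{\log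 n}\qquad(\text{with } 0/0=0 \text{ if } n=1).$$ **Theorem.** Assume $h(\mathbf Y^{(1)})\ne h(\mathbf Y^{(2)})$, and let $\{i,\bar\imath\}=\{1,2\}$. (i) If $\pi:W^{(i)}\to W^{(\bar\imath)}$ is a uniform factor map, $\mu^{(i)}\in\mathcal M_{\max}(W^{(i)})$, $\mu^{(\bar\imath)}\in\mathcal M_{\max}(W^{(\bar\imath)})$ and $\kappa>0$, then $D_\kappa(W^{(i)},\mu^{(i)})$ implies $$\dim W^{(\bar\imath)}=\kappa\,\frac{h_{\mu^{(\bar\imath)}}(W^{(\bar\imath)})}{\log m_{\bar\imath}}=\kappa\,\frac{h_{\pi\mu^{(i)}}(W^{(\bar\imath)})}{\log m_{\bar\imath}} .$$ Suppose moreover that $h(\mathbf Y^{(i)})>h(\mathbf Y^{(\bar\imath)})$ and that $\phi^{(i)}$ has a synchronizing word. Then there is a map $\bar\pi:\mathcal M_{\max}(\mathbf Y^{(i)})\to\mathcal M_{\max}(\mathbf Y^{(\bar\imath)})$ such that: (ii) $\bar\pi$ is continuous and onto, and for every uniform factor map $\pi:W^{(i)}\to W^{(\bar\imath)}$ and every $\mu\in\mathcal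 M_{\max}(W^{(i)})$ one has $\phi^{(i)}\mu\in\mathcal M_{\max}(\mathbf Y^{(i)})$ and $\bar\pi(\phi^{(i)}\mu)=\phi^{(\bar\imath)}(\pi\mu)$; (iii) for every $\nu^{(i)}\in\mathcal M_{\max}(\mathbf Y^{(i)})$ and every $\kappa>0$, if $$\dim\mathbf Y^{(i)}=\kappa\,\frac{h_{\nu^{(i)}}(\mathbf Y^{(i)})}{\log n_i},\quad\text{then}\quad \dim\mathbf Y^{(\bar\imath)}=\kappa\,\frac{h_{\bar\pi\nu^{(i)}}(\mathbf Y^{(\bar\imath)})}{\log n_{\bar\imath}} .$$ -/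

import Mathlib

open MeasureTheory Filter Topology

noncomputable section

/-- The shift map `σ(x)ᵢ = xᵢ₊₁` on the full shift with alphabet `{0, …, n - 1}`. -/
def shift {n : ℕ} (x : ℤ → Fin n) : ℤ → Fin n := fun i => x (i + 1)

/-- A shift space over the alphabet `{0, …, n - 1}`: a shift-invariant set of bi-infinite
sequences. The full shift carries the product topology and its Borel σ-algebra, and a shift
space carries the induced ones. -/
structure ShiftSpace (n : ℕ) where
  carrier : Set (ℤ → Fin n)
  shift_mem : ∀ x ∈ carrier, shift x ∈ carrier

namespace ShiftSpace

variable {m n : ℕ}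

/-- The points of a shift space. -/
abbrev Pt (X : ShiftSpace n) : Type := X.carrier

/-- The shift map of a shift space. -/
def shiftMap (X : ShiftSpace n) (x : X.Pt) : X.Pt := ⟨shift x.1, X.shift_mem x.1 x.2⟩

/-- The words of length `k` that occur in `X`. -/
def words (X : ShiftSpace n) (k : ℕ) : Set (Fin k → Fin n) :=
  {w | ∃ x ∈ X.carrier, ∃ i : ℤ, ∀ l : Fin k, x (i + (l : ℕ)) = w l}

/-- Topological entropy, the growth rate of the number of words
(the sequence converges, by subadditivity, so the upper limit is the limit). -/
def entropy (X : ShiftSpace n) : ℝ :=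
  limsup (fun k : ℕ => Real.log ((X.words k).ncard : ℝ) / k) atTop

/-- The cylinder of the points of `X` that carry the word `w` at the coordinates `0, …, k - 1`. -/
def cylinder (X : ShiftSpace n) {k : ℕ} (w : Fin k → Fin n) : Set X.Pt :=
  {x | ∀ l : Fin k, x.1 ((l : ℕ) : ℤ) = w l}

/-- Measure-theoretic entropy `-lim (1/k) ∑ μ(I) log μ(I)`, the sum over the cylinders of
length `k` (for an invariant measure the sequence converges, by subadditivity). -/
def measureEntropy (X : ShiftSpace n) (μ : ProbabilityMeasure X.Pt) : ℝ :=
  limsup (fun k : ℕ =>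
    (∑ w : Fin k → Fin n, Real.negMulLog ((μ : Measure X.Pt).real (X.cylinder w))) / k) atTop

/-- The set of measures of maximal entropy: shift-invariant Borel probability measures on `X`
whose entropy is the topological entropy of `X`. -/
def maxMeasures (X : ShiftSpace n) : Set (ProbabilityMeasure X.Pt) :=
  {μ | MeasurePreserving X.shiftMap (μ : Measure X.Pt) (μ : Measure X.Pt) ∧
    X.measureEntropy μ = X.entropy}

/-- The metric `d(x, y) = ∑ᵢ |xᵢ - yᵢ| / n ^ (|i| + 1)` on the full shift over `n` symbols. -/
@[reducible] def fullShiftMetric (n : ℕ) : EMetricSpace (ℤ → Fin n) where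
  edist x y := ∑' i : ℤ,
    ENNReal.ofReal (|((x i : ℕ) : ℝ) - ((y i : ℕ) : ℝ)| / (n : ℝ) ^ (i.natAbs + 1))
  edist_self x := by simp
  edist_comm x y := by simp only [abs_sub_comm]
  edist_triangle x y z := by
    rw [← ENNReal.tsum_add]
    refine ENNReal.tsum_le_tsum fun i => ?_
    rw [← ENNReal.ofReal_add (by positivity) (by positivity), ← add_div]
    exact ENNReal.ofReal_le_ofReal (by gcongr; exact abs_sub_le _ _ _)
  eq_of_edist_eq_zero := by
    intro x y h
    funext i
    have hi := ENNReal.tsum_eq_zero.1 h i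
    have hn : 0 < (n : ℝ) := by exact_mod_cast (Fin.pos (x i))
    have hp : 0 < (n : ℝ) ^ (i.natAbs + 1) := pow_pos hn _
    rw [ENNReal.ofReal_eq_zero, div_le_iff₀ hp, zero_mul] at hi
    have h0 := abs_nonpos_iff.1 hi
    exact Fin.ext (by exact_mod_cast sub_eq_zero.1 h0)

/-- The Hausdorff dimension of a shift space with respect to `fullShiftMetric`. -/
def dim (X : ShiftSpace n) : ENNReal := @dimH (ℤ → Fin n) (fullShiftMetric n) X.carrier

/-- The formula `dim X = κ * h_μ(X) / log n`, where `n` is the number of symbols. -/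
def DimFormula (X : ShiftSpace n) (κ : ℝ) (μ : ProbabilityMeasure X.Pt) : Prop :=
  X.dim = ENNReal.ofReal (κ * X.measureEntropy μ / Real.log n)

end ShiftSpace

/-- A factor map: a continuous onto map that commutes with the shifts. -/
structure FactorMap {m n : ℕ} (X : ShiftSpace m) (Y : ShiftSpace n) where
  toFun : X.Pt → Y.Pt
  continuous_toFun : Continuous toFun
  surjective_toFun : Function.Surjective toFun
  semiconj : Function.Semiconj toFun X.shiftMap Y.shiftMap

namespace FactorMap

variable {m n : ℕ} {X : ShiftSpace m} {Y : ShiftSpace n}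

/-- The push-forward of a measure under a factor map. -/
def push (f : FactorMap X Y) (μ : ProbabilityMeasure X.Pt) : ProbabilityMeasure Y.Pt :=
  μ.map f.continuous_toFun.measurable.aemeasurable

/-- Every point has finitely many preimages. -/
def FiniteToOne (f : FactorMap X Y) : Prop := ∀ y : Y.Pt, (f.toFun ⁻¹' {y}).Finite

/-- A uniform factor maps measures of maximal entropy to measures of maximal entropy. -/
def IsUniform (f : FactorMap X Y) : Prop := ∀ μ ∈ X.maxMeasures, f.push μ ∈ Y.maxMeasures

/-- A synchronizing word: a nonempty word `w` of `Y` such that all the preimages of `w` have the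
same terminal entry. If `f` is the one-block code of `Φ`, then the preimages of `w`
are the words `u` of `X` with `Φ(u₀) ⋯ Φ(uₖ) = w`. -/
def HasSynchronizingWord (f : FactorMap X Y) : Prop :=
  ∃ (k : ℕ) (w : Fin (k + 1) → Fin n), w ∈ Y.words (k + 1) ∧
    ∃ a : Fin m, ∀ x : X.Pt, f.toFun x ∈ Y.cylinder w → x.1 k = a

end FactorMap

/-- The topological Markov chain of a `0`-`1` transition matrix. -/
def markovChain {m : ℕ} (T : Matrix (Fin m) (Fin m) ℝ) : ShiftSpace m where
  carrier := {x | ∀ i : ℤ, T (x i) (x (i + 1)) = 1}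
  shift_mem _ hx i := hx (i + 1)

/-- The solution space of a two-layer network with basic set `B` of admissible local patterns of
size `(2 * d + 1) × 2`. The layers are numbered by `0` (hidden) and `1` (output), and the symbols
`0`, `1` stand for the states `-1`, `+1`. -/
def solutionSpace (d : ℕ) (B : Set (Fin 2 → Fin (2 * d + 1) → Fin 2)) :
    Set (Fin 2 → ℤ → Fin 2) :=
  {y | ∀ i : ℤ, (fun (l : Fin 2) (k : Fin (2 * d + 1)) => y l (i - d + (k : ℕ))) ∈ B}

/-- The hidden space (`l = 0`) and the output space (`l = 1`): the projections of the
solution space to its two layers. -/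
def layerSpace (d : ℕ) (B : Set (Fin 2 → Fin (2 * d + 1) → Fin 2)) (l : Fin 2) :
    ShiftSpace 2 where
  carrier := {u | ∃ y ∈ solutionSpace d B, y l = u}
  shift_mem := by
    rintro _ ⟨y, hy, rfl⟩
    refine ⟨fun l => shift (y l), fun i => ?_, rfl⟩
    have h := hy (i + 1)
    have e : (fun (l : Fin 2) (k : Fin (2 * d + 1)) => shift (y l) (i - d + (k : ℕ))) =
        fun (l : Fin 2) (k : Fin (2 * d + 1)) => y l (i + 1 - d + (k : ℕ)) := by
      funext l k
      simp only [shift]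
      congr 1
      ring
    rw [e]
    exact h

end

/-! ### Entropy of finite-valued functions -/

section FiniteEntropy

/-! Every space involved is a factor of an irreducible Markov chain (possibly by the identity), so
any past can be joined to any future by a word of bounded length. This property, `HasBoundedGaps`,
passes to factors and yields two facts.

There is exactly one measure of maximal entropy. Gluing makes the number of words comparable to `exp
(k h)`, and a weak limit of orbit averages is then a Gibbs measure: each nonempty cylinder of length
`k` has mass comparable to `exp (-k h)` (`exists_isGibbs`). Such a measure is ergodic, and every
measure of maximal entropy is absolutely continuous with respect to it, hence equal to it
(`IsGibbs.maxMeasures_eq`).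

The dimension is `2 h / log n` (`dim_eq`). A ball of radius about `n ^ (-p)` fixes about `2 p`
coordinates, so counting words bounds the dimension above and the mass of cylinders for the Gibbs
measure bounds it below.

Hence, for a measure of maximal entropy, the dimension formula says `κ = 2` if `h > 0`, and says
nothing if `h = 0`. It therefore passes to any of these spaces whose entropy is not larger
(`dimFormula_of_dimFormula`). The map between the sets of maximal measures joins two singletons. Its
compatibility with the factor maps requires that finite-to-one maps carry maximal measures to
maximal measures (`FiniteToOne.push_mem_maxMeasures`): a diamond, inserted at the infinitely many
recurrence times of one point, would give that point's image infinitely many preimages. -/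

theorem fiber_prodMk {Ω ι κ : Type*} (f : Ω → ι) (g : Ω → κ) (z : ι × κ) :
    (fun x => (f x, g x)) ⁻¹' {z} = f ⁻¹' {z.1} ∩ g ⁻¹' {z.2} := by
  ext x
  simp [Prod.ext_iff]

variable {Ω ι κ : Type*} [MeasurableSpace Ω] [Fintype ι] [Fintype κ]

/-- The Shannon entropy of the distribution of a function with finitely many values. -/
noncomputable def shannonEntropy (μ : Measure Ω) (f : Ω → ι) : ℝ :=
  ∑ i, Real.negMulLog (μ.real (f ⁻¹' {i}))

theorem sum_measureReal_inter_fiber (μ : Measure Ω) [IsFiniteMeasure μ] {f : Ω → ι}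
    (hf : ∀ i, MeasurableSet (f ⁻¹' {i})) {s : Set Ω} (hs : MeasurableSet s) :
    ∑ i, μ.real (s ∩ f ⁻¹' {i}) = μ.real s := by
  rw [← measureReal_iUnion_fintype]
  · congr 1
    ext x
    simp
  · intro i j hij
    refine Set.disjoint_left.2 ?_
    rintro x ⟨-, hx⟩ ⟨-, hy⟩
    exact hij (hx.symm.trans hy)
  · exact fun i => hs.inter (hf i)

theorem sum_measureReal_fiber (μ : Measure Ω) [IsProbabilityMeasure μ] {f : Ω → ι}
    (hf : ∀ i, MeasurableSet (f ⁻¹' {i})) : ∑ i, μ.real (f ⁻¹' {i}) = 1 := by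
  simpa using sum_measureReal_inter_fiber μ hf MeasurableSet.univ

/-- The Gibbs inequality. -/
theorem sum_negMulLog_le {p q : ι → ℝ} (hp : ∀ i, 0 ≤ p i) (hq : ∀ i, 0 ≤ q i)
    (hp1 : ∑ i, p i = 1) (hq1 : ∑ i, q i ≤ 1) (hpq : ∀ i, q i = 0 → p i = 0) :
    ∑ i, Real.negMulLog (p i) ≤ ∑ i, p i * (-Real.log (q i)) := by
  have key : ∀ i, Real.negMulLog (p i) - p i * (-Real.log (q i)) ≤ q i - p i := by
    intro i
    rcases (hp i).eq_or_lt with h0 | h0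
    · simp [← h0, hq i]
    · have hqi : 0 < q i := lt_of_le_of_ne (hq i) fun h => h0.ne' (hpq i h.symm)
      have h1 : Real.log (q i / p i) ≤ q i / p i - 1 :=
        Real.log_le_sub_one_of_pos (div_pos hqi h0)
      rw [Real.log_div hqi.ne' h0.ne'] at h1
      have h2 := mul_le_mul_of_nonneg_left h1 h0.le
      have h3 : p i * (q i / p i - 1) = q i - p i := by field_simp
      rw [h3] at h2
      simp only [Real.negMulLog]
      linarith
  have := Finset.sum_le_sum fun i (_ : i ∈ Finset.univ) => key i
  simp only [Finset.sum_sub_distrib] at this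
  linarith

variable {μ : Measure Ω} {f : Ω → ι} {g : Ω → κ}

theorem shannonEntropy_equiv (e : ι ≃ κ) : shannonEntropy μ (e ∘ f) = shannonEntropy μ f := by
  unfold shannonEntropy
  rw [← e.sum_comp]
  refine Finset.sum_congr rfl fun i _ => ?_
  congr 2
  ext x
  simp

variable [IsProbabilityMeasure μ]

theorem shannonEntropy_nonneg : 0 ≤ shannonEntropy μ f :=
  Finset.sum_nonneg fun _ _ => Real.negMulLog_nonneg measureReal_nonneg measureReal_le_one

/-- The Gibbs inequality against the uniform distribution on `s`. -/
theorem shannonEntropy_le_log_card (hf : ∀ i, MeasurableSet (f ⁻¹' {i})) {s : Finset ι}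
    (hs : ∀ x, f x ∈ s) : shannonEntropy μ f ≤ Real.log s.card := by
  classical
  obtain ⟨x⟩ : Nonempty Ω := by
    by_contra h
    rw [not_nonempty_iff] at h
    simpa [Set.eq_empty_of_isEmpty] using (measure_univ (μ := μ))
  have hc : (0 : ℝ) < s.card := by exact_mod_cast Finset.card_pos.2 ⟨_, hs x⟩
  have h0 : ∀ i ∉ s, μ.real (f ⁻¹' {i}) = 0 := by
    intro i hi
    have : f ⁻¹' {i} = ∅ := by
      ext y
      simp only [Set.mem_preimage, Set.mem_singleton_iff, Set.mem_empty_iff_false, iff_false]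
      rintro rfl
      exact hi (hs y)
    simp [this]
  have h := sum_negMulLog_le (p := fun i => μ.real (f ⁻¹' {i}))
    (q := fun i => if i ∈ s then (s.card : ℝ)⁻¹ else 0) (fun _ => measureReal_nonneg)
    (fun i => by split_ifs <;> positivity) (sum_measureReal_fiber μ hf)
    (by simp [Finset.sum_ite_mem, hc.ne']) (fun i hi => by
      by_cases his : i ∈ s
      · simp [his, hc.ne'] at hi
      · exact h0 i his)
  refine h.trans (le_of_eq ?_)
  have : ∀ i, μ.real (f ⁻¹' {i}) * (-Real.log (if i ∈ s then (s.card : ℝ)⁻¹ else 0)) =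
      μ.real (f ⁻¹' {i}) * Real.log s.card := by
    intro i
    by_cases his : i ∈ s
    · simp [his]
    · simp [h0 i his]
  simp only [this, ← Finset.sum_mul, sum_measureReal_fiber μ hf, one_mul]

/-- The Gibbs inequality against the product of the two marginals. -/
theorem shannonEntropy_prodMk_le (hf : ∀ i, MeasurableSet (f ⁻¹' {i}))
    (hg : ∀ i, MeasurableSet (g ⁻¹' {i})) :
    shannonEntropy μ (fun x => (f x, g x)) ≤ shannonEntropy μ f + shannonEntropy μ g := by
  have hfg : ∀ z : ι × κ, MeasurableSet ((fun x => (f x, g x)) ⁻¹' {z}) := fun z => by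
    rw [fiber_prodMk]
    exact (hf _).inter (hg _)
  have hle1 : ∀ z : ι × κ, μ.real ((fun x => (f x, g x)) ⁻¹' {z}) ≤ μ.real (f ⁻¹' {z.1}) :=
    fun z => measureReal_mono (by rw [fiber_prodMk]; exact Set.inter_subset_left)
  have hle2 : ∀ z : ι × κ, μ.real ((fun x => (f x, g x)) ⁻¹' {z}) ≤ μ.real (g ⁻¹' {z.2}) :=
    fun z => measureReal_mono (by rw [fiber_prodMk]; exact Set.inter_subset_right)
  have h := sum_negMulLog_le (p := fun z => μ.real ((fun x => (f x, g x)) ⁻¹' {z}))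
    (q := fun z : ι × κ => μ.real (f ⁻¹' {z.1}) * μ.real (g ⁻¹' {z.2}))
    (fun _ => measureReal_nonneg) (fun i => by positivity) (sum_measureReal_fiber μ hfg)
    (by simp [Fintype.sum_prod_type, ← Finset.mul_sum, sum_measureReal_fiber μ hg,
          sum_measureReal_fiber μ hf])
    (fun z hz => by
      rcases mul_eq_zero.1 hz with hz | hz
      · exact le_antisymm ((hle1 z).trans hz.le) measureReal_nonneg
      · exact le_antisymm ((hle2 z).trans hz.le) measureReal_nonneg)
  refine h.trans (le_of_eq ?_)
  have e : ∀ z : ι × κ, μ.real ((fun x => (f x, g x)) ⁻¹' {z}) *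
      (-Real.log (μ.real (f ⁻¹' {z.1}) * μ.real (g ⁻¹' {z.2}))) =
      μ.real (f ⁻¹' {z.1} ∩ g ⁻¹' {z.2}) * (-Real.log (μ.real (f ⁻¹' {z.1}))) +
      μ.real (g ⁻¹' {z.2} ∩ f ⁻¹' {z.1}) * (-Real.log (μ.real (g ⁻¹' {z.2}))) := by
    intro z
    rw [Set.inter_comm (g ⁻¹' _), ← fiber_prodMk]
    by_cases h1 : μ.real (f ⁻¹' {z.1}) = 0
    · have := le_antisymm ((hle1 z).trans h1.le) measureReal_nonneg
      simp [this]
    by_cases h2 : μ.real (g ⁻¹' {z.2}) = 0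
    · have := le_antisymm ((hle2 z).trans h2.le) measureReal_nonneg
      simp [this]
    rw [Real.log_mul h1 h2]
    ring
  simp only [e, Finset.sum_add_distrib]
  congr 1
  · simp only [Fintype.sum_prod_type, ← Finset.sum_mul, sum_measureReal_inter_fiber μ hg (hf _)]
    simp [shannonEntropy, Real.negMulLog]
  · simp only [Fintype.sum_prod_type_right, ← Finset.sum_mul,
      sum_measureReal_inter_fiber μ hf (hg _)]
    simp [shannonEntropy, Real.negMulLog]

/-- If each value of `g` is compatible with at most `M` values of `f`, then `f` carries at most
`log M` more entropy than `g`. -/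
theorem shannonEntropy_le_add_log (hf : ∀ i, MeasurableSet (f ⁻¹' {i}))
    (hg : ∀ i, MeasurableSet (g ⁻¹' {i})) {M : ℕ}
    (hM : ∀ j, (f '' (g ⁻¹' {j})).ncard ≤ M) :
    shannonEntropy μ f ≤ shannonEntropy μ g + Real.log M := by
  classical
  have hfg : ∀ z : ι × κ, MeasurableSet ((fun x => (f x, g x)) ⁻¹' {z}) := fun z => by
    rw [fiber_prodMk]
    exact (hf _).inter (hg _)
  have hle2 : ∀ z : ι × κ, μ.real ((fun x => (f x, g x)) ⁻¹' {z}) ≤ μ.real (g ⁻¹' {z.2}) :=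
    fun z => measureReal_mono (by rw [fiber_prodMk]; exact Set.inter_subset_right)
  have h0 : ∀ z : ι × κ, z.1 ∉ f '' (g ⁻¹' {z.2}) →
      μ.real ((fun x => (f x, g x)) ⁻¹' {z}) = 0 := by
    intro z hz
    have : (fun x => (f x, g x)) ⁻¹' {z} = ∅ := by
      rw [fiber_prodMk]
      ext y
      simp only [Set.mem_inter_iff, Set.mem_preimage, Set.mem_singleton_iff,
        Set.mem_empty_iff_false, iff_false, not_and]
      intro h1 h2
      exact hz ⟨y, h2, h1⟩
    simp [this]
  obtain ⟨x⟩ : Nonempty Ω := by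
    by_contra h
    rw [not_nonempty_iff] at h
    simpa [Set.eq_empty_of_isEmpty] using (measure_univ (μ := μ))
  have hM0 : (0 : ℝ) < M := by
    have : 0 < (f '' (g ⁻¹' {g x})).ncard :=
      (Set.ncard_pos (Set.toFinite _)).2 ⟨f x, x, rfl, rfl⟩
    exact_mod_cast this.trans_le (hM _)
  -- The joint law refines the law of `f`: split each mass over the values of `g` and compare
  -- logarithms term by term.
  have step : shannonEntropy μ f ≤ shannonEntropy μ fun x => (f x, g x) := by
    have e : ∀ i, Real.negMulLog (μ.real (f ⁻¹' {i})) =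
        ∑ j, μ.real (f ⁻¹' {i} ∩ g ⁻¹' {j}) * (-Real.log (μ.real (f ⁻¹' {i}))) := by
      intro i
      rw [← Finset.sum_mul, sum_measureReal_inter_fiber μ hg (hf _)]
      simp [Real.negMulLog]
    unfold shannonEntropy
    simp only [e]
    rw [Fintype.sum_prod_type]
    refine Finset.sum_le_sum fun i _ => Finset.sum_le_sum fun j _ => ?_
    rw [fiber_prodMk]
    rcases (measureReal_nonneg (μ := μ) (s := f ⁻¹' {i} ∩ g ⁻¹' {j})).eq_or_lt with hz | hz
    · simp [← hz]
    · have := Real.log_le_log hz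
        (measureReal_mono (μ := μ) (Set.inter_subset_left (s := f ⁻¹' {i}) (t := g ⁻¹' {j})))
      simp only [Real.negMulLog]
      nlinarith
  refine step.trans ?_
  -- The reference weights give each of the at most `M` compatible values of `f` a share `1 / M` of
  -- the mass of the fibre of `g`.
  have h := sum_negMulLog_le (p := fun z => μ.real ((fun x => (f x, g x)) ⁻¹' {z}))
    (q := fun z : ι × κ => if z.1 ∈ f '' (g ⁻¹' {z.2}) then μ.real (g ⁻¹' {z.2}) * (M : ℝ)⁻¹ else 0)
    (fun _ => measureReal_nonneg) (fun i => by split_ifs <;> positivity)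
    (sum_measureReal_fiber μ hfg)
    (by
      rw [Fintype.sum_prod_type_right, ← sum_measureReal_fiber μ hg]
      refine Finset.sum_le_sum fun j _ => ?_
      simp only [← Finset.sum_filter, Finset.sum_const, nsmul_eq_mul]
      have hc : ((Finset.univ.filter fun i => i ∈ f '' (g ⁻¹' {j})).card : ℝ) ≤ M := by
        have := hM j
        rw [Set.ncard_eq_toFinset_card'] at this
        refine le_trans (le_of_eq ?_) (Nat.cast_le.2 this)
        congr 2
        ext
        simp
      calc _ ≤ (M : ℝ) * (μ.real (g ⁻¹' {j}) * (M : ℝ)⁻¹) :=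
            mul_le_mul_of_nonneg_right hc (by positivity)
        _ = _ := by field_simp)
    (fun z hz => by
      by_cases hzs : z.1 ∈ f '' (g ⁻¹' {z.2})
      · simp only [hzs, if_true, mul_eq_zero, inv_eq_zero, hM0.ne', or_false] at hz
        exact le_antisymm ((hle2 z).trans hz.le) measureReal_nonneg
      · exact h0 z hzs)
  refine h.trans (le_of_eq ?_)
  have e : ∀ z : ι × κ, μ.real ((fun x => (f x, g x)) ⁻¹' {z}) *
      (-Real.log (if z.1 ∈ f '' (g ⁻¹' {z.2}) then μ.real (g ⁻¹' {z.2}) * (M : ℝ)⁻¹ else 0)) =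
      μ.real (g ⁻¹' {z.2} ∩ f ⁻¹' {z.1}) * (-Real.log (μ.real (g ⁻¹' {z.2}))) +
      μ.real ((fun x => (f x, g x)) ⁻¹' {z}) * Real.log M := by
    intro z
    rw [Set.inter_comm (g ⁻¹' _), ← fiber_prodMk]
    by_cases hzs : z.1 ∈ f '' (g ⁻¹' {z.2})
    · by_cases h2 : μ.real (g ⁻¹' {z.2}) = 0
      · have := le_antisymm ((hle2 z).trans h2.le) measureReal_nonneg
        simp [this]
      · rw [if_pos hzs, Real.log_mul h2 (inv_ne_zero hM0.ne'), Real.log_inv]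
        ring
    · simp [h0 z hzs]
  simp only [e, Finset.sum_add_distrib, ← Finset.sum_mul, sum_measureReal_fiber μ hfg, one_mul]
  congr 1
  simp only [Fintype.sum_prod_type_right, ← Finset.sum_mul,
    sum_measureReal_inter_fiber μ hf (hg _)]
  simp [shannonEntropy, Real.negMulLog]

end FiniteEntropy

/-! ### Shift spaces with bounded gaps -/

namespace ShiftSpace

variable {n : ℕ} {X : ShiftSpace n} {N : ℕ}

/-- The word that a point carries at the coordinates `0, …, k - 1`. -/
def headWord (X : ShiftSpace n) (k : ℕ) (x : X.Pt) : Fin k → Fin n := fun l => x.1 ((l : ℕ) : ℤ)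

theorem cylinder_eq_preimage {k : ℕ} (w : Fin k → Fin n) :
    X.cylinder w = X.headWord k ⁻¹' {w} := by
  ext x
  simp [cylinder, headWord, funext_iff]

theorem shiftMap_iterate_apply (x : X.Pt) (j : ℕ) (i : ℤ) :
    (X.shiftMap^[j] x).1 i = x.1 (i + j) := by
  induction j generalizing x with
  | zero => simp
  | succ j ih =>
    rw [Function.iterate_succ_apply, ih]
    simp only [shiftMap, shift]
    push_cast
    ring_nf

theorem headWord_eq_iff {k : ℕ} {x y : X.Pt} :
    X.headWord k x = X.headWord k y ↔ ∀ i : ℤ, 0 ≤ i → i < k → x.1 i = y.1 i := by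
  constructor
  · intro h i h0 hk
    lift i to ℕ using h0
    exact congrFun h ⟨i, by exact_mod_cast hk⟩
  · intro h
    funext l
    exact h _ (by positivity) (by exact_mod_cast l.2)

/-- A nonempty closed shift space in which the past of a point and the future of another one can
be joined by a word of length at most `N`. -/
structure HasBoundedGaps (X : ShiftSpace n) (N : ℕ) : Prop where
  isClosed : IsClosed X.carrier
  nonempty : X.carrier.Nonempty
  translate_mem : ∀ x ∈ X.carrier, ∀ t : ℤ, (fun i => x (i + t)) ∈ X.carrier
  glue : ∀ x ∈ X.carrier, ∀ y ∈ X.carrier, ∃ g ≤ N, ∃ z ∈ X.carrier,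
    (∀ i < 0, z i = x i) ∧ ∀ i : ℤ, 0 ≤ i → z (i + (g : ℕ)) = y i

namespace HasBoundedGaps

/-- The translate of a point by an integer. -/
def translate (hX : X.HasBoundedGaps N) (t : ℤ) (x : X.Pt) : X.Pt :=
  ⟨fun i => x.1 (i + t), hX.translate_mem x.1 x.2 t⟩

@[simp] theorem translate_apply (hX : X.HasBoundedGaps N) (t : ℤ) (x : X.Pt) (i : ℤ) :
    (hX.translate t x).1 i = x.1 (i + t) := rfl

theorem compactSpace (hX : X.HasBoundedGaps N) : CompactSpace X.Pt :=
  isCompact_iff_compactSpace.1 hX.isClosed.isCompact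

theorem nonempty_pt (hX : X.HasBoundedGaps N) : Nonempty X.Pt := hX.nonempty.to_subtype

theorem words_eq_range (hX : X.HasBoundedGaps N) (k : ℕ) :
    X.words k = Set.range (X.headWord k) := by
  ext w
  constructor
  · rintro ⟨x, hx, i, h⟩
    refine ⟨hX.translate i ⟨x, hx⟩, funext fun l => ?_⟩
    rw [← h l]
    simp [headWord, add_comm]
  · rintro ⟨x, rfl⟩
    exact ⟨x.1, x.2, 0, fun l => by simp [headWord]⟩

theorem headWord_mem (hX : X.HasBoundedGaps N) (k : ℕ) (x : X.Pt) :
    X.headWord k x ∈ X.words k := by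
  rw [hX.words_eq_range]
  exact ⟨x, rfl⟩

/-- A point with a prescribed initial word. -/
noncomputable def point (hX : X.HasBoundedGaps N) {k : ℕ} (w : X.words k) : X.Pt :=
  (show (w : Fin k → Fin n) ∈ Set.range (X.headWord k) from hX.words_eq_range k ▸ w.2).choose

theorem headWord_point (hX : X.HasBoundedGaps N) {k : ℕ} (w : X.words k) :
    X.headWord k (hX.point w) = w :=
  (show (w : Fin k → Fin n) ∈ Set.range (X.headWord k) from
    hX.words_eq_range k ▸ w.2).choose_spec

theorem ext_point (hX : X.HasBoundedGaps N) {k : ℕ} {v w : X.words k}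
    (h : ∀ i : ℤ, 0 ≤ i → i < k → (hX.point v).1 i = (hX.point w).1 i) : v = w := by
  apply Subtype.ext
  rw [← hX.headWord_point v, ← hX.headWord_point w]
  exact headWord_eq_iff.2 h

theorem point_apply_of_headWord_eq (hX : X.HasBoundedGaps N) {k : ℕ} {w : X.words k} {x : X.Pt}
    (h : X.headWord k x = w) {i : ℤ} (h0 : 0 ≤ i) (hk : i < k) :
    (hX.point w).1 i = x.1 i :=
  headWord_eq_iff.1 ((hX.headWord_point w).trans h.symm) i h0 hk

theorem glue_at (hX : X.HasBoundedGaps N) (x y : X.Pt) (a : ℤ) : ∃ g ≤ N, ∃ z : X.Pt,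
    (∀ i < a, z.1 i = x.1 i) ∧ ∀ i : ℤ, 0 ≤ i → z.1 (a + (g : ℕ) + i) = y.1 i := by
  obtain ⟨g, hg, z, hz, h1, h2⟩ := hX.glue (hX.translate a x).1 (hX.translate a x).2 y.1 y.2
  refine ⟨g, hg, hX.translate (-a) ⟨z, hz⟩, fun i hi => ?_, fun i hi => ?_⟩
  · have := h1 (i + -a) (by linarith)
    simp only [translate_apply] at this ⊢
    rw [this]
    ring_nf
  · rw [← h2 i hi, translate_apply]
    ring_nf

theorem glue_three (hX : X.HasBoundedGaps N) (x y z : X.Pt) (a b : ℕ) :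
    ∃ (g g' : Fin (N + 1)) (t : X.Pt),
      (∀ i : ℤ, i < a → t.1 i = x.1 i) ∧
      (∀ i : ℤ, 0 ≤ i → i < b → t.1 (a + (g : ℕ) + i) = y.1 i) ∧
      ∀ i : ℤ, 0 ≤ i → t.1 (a + (g : ℕ) + b + (g' : ℕ) + i) = z.1 i := by
  obtain ⟨g', hg', s, h1, h2⟩ := hX.glue_at y z b
  obtain ⟨g, hg, t, h3, h4⟩ := hX.glue_at x s a
  refine ⟨⟨g, by omega⟩, ⟨g', by omega⟩, t, h3, fun i h0 hb => ?_, fun i h0 => ?_⟩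
  · rw [h4 i h0, h1 i hb]
  · rw [← h2 i h0, ← h4 _ (by positivity)]
    simp only
    ring_nf

/-! ### Growth of the number of words. -/

theorem words_nonempty (hX : X.HasBoundedGaps N) (k : ℕ) : (X.words k).Nonempty := by
  obtain ⟨x⟩ := hX.nonempty_pt
  exact ⟨_, hX.headWord_mem k x⟩

theorem ncard_words_pos (hX : X.HasBoundedGaps N) (k : ℕ) : 0 < (X.words k).ncard :=
  (Set.ncard_pos (Set.toFinite _)).2 (hX.words_nonempty k)

theorem ncard_words_le (X : ShiftSpace n) (k : ℕ) : (X.words k).ncard ≤ n ^ k := by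
  calc (X.words k).ncard ≤ (Set.univ : Set (Fin k → Fin n)).ncard :=
        Set.ncard_le_ncard (Set.subset_univ _)
    _ = n ^ k := by simp [Set.ncard_univ]

theorem alphabet_pos (hX : X.HasBoundedGaps N) : 0 < n := by
  obtain ⟨x⟩ := hX.nonempty_pt
  exact Fin.pos (x.1 0)

theorem ncard_words_add_le (hX : X.HasBoundedGaps N) (a b : ℕ) :
    (X.words (a + b)).ncard ≤ (X.words a).ncard * (X.words b).ncard := by
  simp only [← Nat.card_coe_set_eq, ← Nat.card_prod]
  refine Nat.card_le_card_of_injective (fun w : X.words (a + b) =>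
    ((⟨_, hX.headWord_mem a (hX.point w)⟩ : X.words a),
      (⟨_, hX.headWord_mem b (hX.translate a (hX.point w))⟩ : X.words b))) ?_
  intro v w h
  simp only [Prod.mk.injEq, Subtype.mk.injEq, headWord_eq_iff, translate_apply] at h
  refine hX.ext_point fun i h0 hi => ?_
  rcases lt_or_ge i a with hia | hia
  · exact h.1 i h0 hia
  · simpa using h.2 (i - a) (by linarith) (by push_cast at hi; linarith)

/-- The constant in the supermultiplicativity of the number of words. -/
def gapConst (n N : ℕ) : ℕ := (N + 1) * n ^ N

/-- Glue the two words. The gap can push up to `N` letters of the second one beyond coordinate `a +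
b`, so the pair is recovered from the first `a + b` letters, the next `N` letters and the gap
length. -/
theorem ncard_words_mul_le (hX : X.HasBoundedGaps N) (a b : ℕ) :
    (X.words a).ncard * (X.words b).ncard ≤ gapConst n N * (X.words (a + b)).ncard := by
  have key : ∀ p : X.words a × X.words b, ∃ (g : Fin (N + 1)) (z : X.Pt),
      (∀ i : ℤ, i < a → z.1 i = (hX.point p.1).1 i) ∧
      ∀ i : ℤ, 0 ≤ i → z.1 (a + (g : ℕ) + i) = (hX.point p.2).1 i := by
    intro p
    obtain ⟨g, hg, z, h⟩ := hX.glue_at (hX.point p.1) (hX.point p.2) a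
    exact ⟨⟨g, by omega⟩, z, h⟩
  choose g z h1 h2 using key
  have hcard : gapConst n N * (X.words (a + b)).ncard =
      Nat.card ((Fin (N + 1) × (Fin N → Fin n)) × X.words (a + b)) := by
    simp [Nat.card_prod, gapConst, Nat.card_coe_set_eq]
  rw [hcard]
  simp only [← Nat.card_coe_set_eq, ← Nat.card_prod]
  refine Nat.card_le_card_of_injective (fun p : X.words a × X.words b =>
    ((g p, X.headWord N (hX.translate (a + b : ℕ) (z p))),
      (⟨_, hX.headWord_mem (a + b) (z p)⟩ : X.words (a + b)))) ?_
  intro p q h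
  simp only [Prod.mk.injEq, Subtype.mk.injEq, headWord_eq_iff, translate_apply] at h
  obtain ⟨⟨hg, hN⟩, hw⟩ := h
  have hz : ∀ i : ℤ, 0 ≤ i → i < a + b + N → (z p).1 i = (z q).1 i := by
    intro i h0 hi
    rcases lt_or_ge i (a + b) with hia | hia
    · exact hw i h0 (by exact_mod_cast hia)
    · simpa using hN (i - (a + b)) (by linarith) (by linarith)
  refine Prod.ext (hX.ext_point fun i h0 hi => ?_) (hX.ext_point fun i h0 hi => ?_)
  · rw [← h1 p i hi, ← h1 q i hi]
    exact hz i h0 (by linarith)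
  · rw [← h2 p i h0, ← h2 q i h0, hg]
    have : ((g q : ℕ) : ℤ) ≤ N := by exact_mod_cast Nat.lt_succ_iff.1 (g q).2
    exact hz _ (by positivity) (by linarith)

theorem gapConst_pos (hX : X.HasBoundedGaps N) : 0 < gapConst n N :=
  Nat.mul_pos N.succ_pos (pow_pos hX.alphabet_pos N)

theorem subadditive_log_ncard_words (hX : X.HasBoundedGaps N) :
    Subadditive fun k => Real.log (X.words k).ncard := by
  intro a b
  have ha : ((X.words a).ncard : ℝ) ≠ 0 := by exact_mod_cast (hX.ncard_words_pos a).ne'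
  have hb : ((X.words b).ncard : ℝ) ≠ 0 := by exact_mod_cast (hX.ncard_words_pos b).ne'
  rw [← Real.log_mul ha hb]
  exact Real.log_le_log (by exact_mod_cast hX.ncard_words_pos _)
    (by exact_mod_cast hX.ncard_words_add_le a b)

theorem bddBelow_log_ncard_words (X : ShiftSpace n) :
    BddBelow (Set.range fun k : ℕ => Real.log (X.words k).ncard / k) :=
  ⟨0, by rintro _ ⟨k, rfl⟩; exact div_nonneg (Real.log_natCast_nonneg _) (Nat.cast_nonneg _)⟩

theorem tendsto_entropy (hX : X.HasBoundedGaps N) :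
    Tendsto (fun k : ℕ => Real.log (X.words k).ncard / k) atTop (𝓝 X.entropy) := by
  have h := hX.subadditive_log_ncard_words.tendsto_lim (bddBelow_log_ncard_words X)
  rwa [← h.limsup_eq] at h

theorem entropy_nonneg (hX : X.HasBoundedGaps N) : 0 ≤ X.entropy :=
  ge_of_tendsto' hX.tendsto_entropy fun _ =>
    div_nonneg (Real.log_natCast_nonneg _) (Nat.cast_nonneg _)

theorem entropy_le_log (hX : X.HasBoundedGaps N) : X.entropy ≤ Real.log n := by
  refine le_of_tendsto hX.tendsto_entropy ?_
  filter_upwards [eventually_gt_atTop 0] with k hk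
  rw [div_le_iff₀ (by exact_mod_cast hk), mul_comm, ← Real.log_pow]
  exact Real.log_le_log (by exact_mod_cast hX.ncard_words_pos _)
    (by exact_mod_cast ncard_words_le X k)

/-- By Fekete's lemma the entropy is the infimum, not only the limit, of the normalised logarithms.
-/
theorem exp_le_ncard_words (hX : X.HasBoundedGaps N) (k : ℕ) :
    Real.exp (X.entropy * k) ≤ (X.words k).ncard := by
  have hpos : (0 : ℝ) < (X.words k).ncard := by exact_mod_cast hX.ncard_words_pos k
  rcases Nat.eq_zero_or_pos k with rfl | hk
  · simpa using Nat.one_le_iff_ne_zero.2 (hX.ncard_words_pos 0).ne'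
  · rw [← Real.le_log_iff_exp_le hpos, ← le_div_iff₀ (by exact_mod_cast hk)]
    have h := hX.subadditive_log_ncard_words.tendsto_lim (bddBelow_log_ncard_words X)
    rw [tendsto_nhds_unique hX.tendsto_entropy h]
    exact hX.subadditive_log_ncard_words.lim_le_div (bddBelow_log_ncard_words X) hk.ne'

/-- Fekete's lemma in the other direction: supermultiplicativity up to a constant makes `log
(gapConst n N) - log (X.words k).ncard` subadditive, with limit `-h` after division by `k`. -/
theorem ncard_words_le_exp (hX : X.HasBoundedGaps N) (k : ℕ) :
    ((X.words k).ncard : ℝ) ≤ gapConst n N * Real.exp (X.entropy * k) := by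
  have hpos : ∀ k, (0 : ℝ) < (X.words k).ncard := fun k => by exact_mod_cast hX.ncard_words_pos k
  have hK : (1 : ℝ) ≤ gapConst n N := by exact_mod_cast hX.gapConst_pos
  rcases Nat.eq_zero_or_pos k with rfl | hk
  · have := ncard_words_le X 0
    simp only [pow_zero] at this
    simpa using this.trans hX.gapConst_pos
  have hsub : Subadditive fun k => Real.log (gapConst n N) - Real.log (X.words k).ncard := by
    intro a b
    have h : ((X.words a).ncard : ℝ) * (X.words b).ncard ≤ gapConst n N * (X.words (a + b)).ncard :=
      by exact_mod_cast hX.ncard_words_mul_le a b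
    have := Real.log_le_log (mul_pos (hpos a) (hpos b)) h
    rw [Real.log_mul (hpos a).ne' (hpos b).ne', Real.log_mul (by linarith) (hpos _).ne'] at this
    simp only
    linarith
  have hbdd : BddBelow (Set.range fun k : ℕ =>
      (Real.log (gapConst n N) - Real.log (X.words k).ncard) / k) := by
    refine ⟨-Real.log n, ?_⟩
    rintro _ ⟨k, rfl⟩
    rcases Nat.eq_zero_or_pos k with rfl | hk
    · simpa using Real.log_natCast_nonneg n
    simp only
    rw [le_div_iff₀ (by exact_mod_cast hk)]
    have := Real.log_le_log (hpos k) (show ((X.words k).ncard : ℝ) ≤ (n : ℝ) ^ k by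
      exact_mod_cast ncard_words_le X k)
    rw [Real.log_pow] at this
    linarith [Real.log_nonneg hK]
  have hlim : Tendsto (fun k : ℕ => (Real.log (gapConst n N) - Real.log (X.words k).ncard) / k)
      atTop (𝓝 (0 - X.entropy)) := by
    simp only [sub_div]
    exact (tendsto_const_div_atTop_nhds_zero_nat _).sub hX.tendsto_entropy
  have h := hsub.lim_le_div hbdd hk.ne'
  rw [tendsto_nhds_unique (hsub.tendsto_lim hbdd) hlim, le_div_iff₀ (by exact_mod_cast hk)] at h
  rw [← Real.log_le_log_iff (hpos k) (by positivity),
    Real.log_mul (by linarith) (Real.exp_pos _).ne', Real.log_exp]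
  linarith

end HasBoundedGaps

end ShiftSpace

/-! ### Construction of a Gibbs measure -/

namespace ShiftSpace

variable {n : ℕ} {X : ShiftSpace n} {N : ℕ}

theorem continuous_shiftMap (X : ShiftSpace n) : Continuous X.shiftMap := by
  refine Continuous.subtype_mk (continuous_pi fun i => ?_) _
  exact (continuous_apply (i + 1)).comp continuous_subtype_val

theorem continuous_headWord (X : ShiftSpace n) (k : ℕ) : Continuous (X.headWord k) :=
  continuous_pi fun l => (continuous_apply ((l : ℕ) : ℤ)).comp continuous_subtype_val

theorem isClopen_cylinder (X : ShiftSpace n) {k : ℕ} (w : Fin k → Fin n) :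
    IsClopen (X.cylinder w) := by
  rw [cylinder_eq_preimage]
  exact (isClopen_discrete {w}).preimage (X.continuous_headWord k)

theorem mem_cylinder_headWord {k : ℕ} {x y : X.Pt} :
    y ∈ X.cylinder (X.headWord k x) ↔ ∀ i : ℤ, 0 ≤ i → i < k → y.1 i = x.1 i := by
  rw [cylinder_eq_preimage]
  exact headWord_eq_iff

/-- The measure of a cylinder of length `k` is `exp (-k h)`, up to constants. -/
structure IsGibbs (X : ShiftSpace n) (ν : ProbabilityMeasure X.Pt) (c C : ℝ) : Prop where
  measurePreserving : MeasurePreserving X.shiftMap (ν : Measure X.Pt) (ν : Measure X.Pt)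
  pos : 0 < c
  le_measure : ∀ (k : ℕ) (x : X.Pt), c * Real.exp (-(X.entropy * k)) ≤
    (ν : Measure X.Pt).real (X.cylinder (X.headWord k x))
  measure_le : ∀ (k : ℕ) (x : X.Pt), (ν : Measure X.Pt).real (X.cylinder (X.headWord k x)) ≤
    C * Real.exp (-(X.entropy * k))

namespace HasBoundedGaps

/-! ### Visits of the chosen points to a cylinder. -/

open scoped Classical in
/-- The number of words of length `L` whose chosen point lies in `S` after `j` shifts. -/
noncomputable def visitCount (hX : X.HasBoundedGaps N) (L : ℕ) (S : Set X.Pt) (j : ℕ) : ℕ :=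
  (Finset.univ.filter fun w : X.words L => X.shiftMap^[j] (hX.point w) ∈ S).card

theorem visitCount_eq_natCard (hX : X.HasBoundedGaps N) (L : ℕ) (S : Set X.Pt) (j : ℕ) :
    hX.visitCount L S j = Nat.card {w : X.words L // X.shiftMap^[j] (hX.point w) ∈ S} := by
  classical
  rw [visitCount, Nat.card_eq_fintype_card, Fintype.card_subtype]

theorem visitCount_le (hX : X.HasBoundedGaps N) (L : ℕ) (S : Set X.Pt) (j : ℕ) :
    hX.visitCount L S j ≤ (X.words L).ncard := by
  rw [visitCount_eq_natCard, ← Nat.card_coe_set_eq]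
  exact Nat.card_le_card_of_injective _ Subtype.val_injective

theorem visitCount_preimage_shiftMap (hX : X.HasBoundedGaps N) (L : ℕ) (S : Set X.Pt) (j : ℕ) :
    hX.visitCount L (X.shiftMap ⁻¹' S) j = hX.visitCount L S (j + 1) := by
  simp only [visitCount_eq_natCard, Function.iterate_succ_apply', Set.mem_preimage]

/-- Once the block at `j, …, j + l - 1` is prescribed, a word of length `L` is determined by what
precedes and what follows it. -/
theorem visitCount_cylinder_le (hX : X.HasBoundedGaps N) {L l j : ℕ} (hj : j + l ≤ L) (x : X.Pt) :
    hX.visitCount L (X.cylinder (X.headWord l x)) j ≤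
      (X.words j).ncard * (X.words (L - j - l)).ncard := by
  rw [visitCount_eq_natCard]
  simp only [← Nat.card_coe_set_eq, ← Nat.card_prod]
  refine Nat.card_le_card_of_injective (fun w =>
    ((⟨_, hX.headWord_mem j (hX.point w.1)⟩ : X.words j),
      (⟨_, hX.headWord_mem (L - j - l) (hX.translate (j + l : ℕ) (hX.point w.1))⟩ :
        X.words (L - j - l)))) ?_
  rintro ⟨v, hv⟩ ⟨w, hw⟩ h
  simp only [Prod.mk.injEq, Subtype.mk.injEq, headWord_eq_iff, translate_apply] at h
  simp only [mem_cylinder_headWord, shiftMap_iterate_apply] at hv hw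
  refine Subtype.ext (hX.ext_point fun i h0 hi => ?_)
  rcases lt_or_ge i j with hij | hij
  · exact h.1 i h0 hij
  rcases lt_or_ge i (j + l) with hil | hil
  · have h1 := hv (i - j) (by linarith) (by linarith)
    have h2 := hw (i - j) (by linarith) (by linarith)
    simp only [sub_add_cancel] at h1 h2
    rw [h1, h2]
  · simpa using h.2 (i - (j + l)) (by linarith) (by push_cast [Nat.sub_sub]; omega)

/-- Glue a prefix, the block of `x` and a suffix. Shortening prefix and suffix by `N` leaves room
for both gaps, so the triple is recovered up to the `(N + 1) ^ 2` choices of gap lengths. -/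
theorem le_visitCount_cylinder (hX : X.HasBoundedGaps N) {L l j : ℕ} (hj : N ≤ j)
    (hjl : j + l + N ≤ L) (x : X.Pt) :
    (X.words (j - N)).ncard * (X.words (L - j - l - N)).ncard ≤
      (N + 1) ^ 2 * hX.visitCount L (X.cylinder (X.headWord l x)) j := by
  have key := fun p : X.words (j - N) × X.words (L - j - l - N) =>
    hX.glue_three (hX.point p.1) x (hX.point p.2) (j - N) l
  choose g g' t h1 h2 h3 using key
  have hg : ∀ p, ((g p : ℕ) : ℤ) ≤ N := fun p => by exact_mod_cast Nat.lt_succ_iff.1 (g p).2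
  have hg' : ∀ p, ((g' p : ℕ) : ℤ) ≤ N := fun p => by exact_mod_cast Nat.lt_succ_iff.1 (g' p).2
  have hjN : ((j - N : ℕ) : ℤ) = j - N := by push_cast [hj]; ring
  have hL : ((L - j - l - N : ℕ) : ℤ) = L - j - l - N := by omega
  -- In `t p` the block starts at `j - N + g`; this translation moves it to `j` whatever the gap.
  -- The prefix then starts at `N - g ≥ 0` and the suffix ends at `L - N + g' ≤ L`, so no letter
  -- leaves the window.
  let s : X.words (j - N) × X.words (L - j - l - N) → X.Pt :=
    fun p => hX.translate ((g p : ℕ) - N) (t p)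
  let w : X.words (j - N) × X.words (L - j - l - N) → X.words L :=
    fun p => ⟨_, hX.headWord_mem L (s p)⟩
  have hw : ∀ p (i : ℤ), 0 ≤ i → i < L →
      (hX.point (w p)).1 i = (t p).1 (i + ((g p : ℕ) - N)) := by
    intro p i h0 hi
    exact hX.point_apply_of_headWord_eq (w := w p) (x := s p) rfl h0 hi
  have hmem : ∀ p, X.shiftMap^[j] (hX.point (w p)) ∈ X.cylinder (X.headWord l x) := by
    intro p
    rw [mem_cylinder_headWord]
    intro i h0 hi
    rw [shiftMap_iterate_apply, hw p _ (by positivity) (by omega), ← h2 p i h0 hi, hjN]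
    ring_nf
  have hcard : (N + 1) ^ 2 * hX.visitCount L (X.cylinder (X.headWord l x)) j =
      Nat.card ((Fin (N + 1) × Fin (N + 1)) ×
        {w : X.words L // X.shiftMap^[j] (hX.point w) ∈ X.cylinder (X.headWord l x)}) := by
    rw [visitCount_eq_natCard, Nat.card_prod, Nat.card_prod]
    simp [sq]
  rw [hcard]
  simp only [← Nat.card_coe_set_eq, ← Nat.card_prod]
  refine Nat.card_le_card_of_injective (fun p => ((g p, g' p), ⟨w p, hmem p⟩)) ?_
  intro p q h
  simp only [Prod.mk.injEq, Subtype.mk.injEq] at h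
  obtain ⟨⟨hgg, hgg'⟩, hww⟩ := h
  have ht : ∀ i : ℤ, 0 ≤ i → i < L →
      (t p).1 (i + ((g p : ℕ) - N)) = (t q).1 (i + ((g p : ℕ) - N)) := by
    intro i h0 hi
    have h4 := hw p i h0 hi
    rw [hww, hw q i h0 hi, ← hgg] at h4
    exact h4.symm
  have hgp := hg p
  have hgp' := hg' p
  refine Prod.ext (hX.ext_point fun i h0 hi => ?_) (hX.ext_point fun i h0 hi => ?_)
  · rw [← h1 p i hi, ← h1 q i hi]
    have := ht (i - ((g p : ℕ) - N)) (by linarith) (by omega)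
    simpa using this
  · rw [← h3 p i h0, ← h3 q i h0, ← hgg, ← hgg']
    have := ht (((j - N : ℕ) : ℤ) + (g p : ℕ) + l + (g' p : ℕ) + i - ((g p : ℕ) - N))
      (by omega) (by omega)
    simpa using this

theorem visitCount_cylinder_le_exp (hX : X.HasBoundedGaps N) {L l j : ℕ} (hj : j + l ≤ L)
    (x : X.Pt) : (hX.visitCount L (X.cylinder (X.headWord l x)) j : ℝ) ≤
      gapConst n N ^ 2 * Real.exp (X.entropy * (L - l)) := by
  calc (hX.visitCount L (X.cylinder (X.headWord l x)) j : ℝ)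
      ≤ (X.words j).ncard * (X.words (L - j - l)).ncard := by
        exact_mod_cast hX.visitCount_cylinder_le hj x
    _ ≤ (gapConst n N * Real.exp (X.entropy * j)) *
        (gapConst n N * Real.exp (X.entropy * (L - j - l : ℕ))) :=
        mul_le_mul (hX.ncard_words_le_exp _) (hX.ncard_words_le_exp _) (by positivity)
          (by positivity)
    _ = _ := by
        have : ((L - j - l : ℕ) : ℝ) = L - j - l := by
          rw [Nat.sub_sub, Nat.cast_sub hj]; push_cast; ring
        rw [this, mul_mul_mul_comm, ← Real.exp_add, sq]
        ring_nf

theorem exp_le_visitCount_cylinder (hX : X.HasBoundedGaps N) {L l j : ℕ} (hj : N ≤ j)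
    (hjl : j + l + N ≤ L) (x : X.Pt) : Real.exp (X.entropy * (L - l - 2 * N)) ≤
      (N + 1) ^ 2 * (hX.visitCount L (X.cylinder (X.headWord l x)) j : ℝ) := by
  calc Real.exp (X.entropy * (L - l - 2 * N))
      = Real.exp (X.entropy * (j - N : ℕ)) * Real.exp (X.entropy * (L - j - l - N : ℕ)) := by
        have h1 : ((L - j - l - N : ℕ) : ℝ) = L - j - l - N := by
          rw [Nat.sub_sub, Nat.sub_sub, ← add_assoc, Nat.cast_sub hjl]; push_cast; ring
        rw [h1, Nat.cast_sub hj, ← Real.exp_add]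
        ring_nf
    _ ≤ (X.words (j - N)).ncard * (X.words (L - j - l - N)).ncard :=
        mul_le_mul (hX.exp_le_ncard_words _) (hX.exp_le_ncard_words _) (by positivity)
          (by positivity)
    _ ≤ _ := by exact_mod_cast hX.le_visitCount_cylinder hj hjl x

/-! ### Orbit averages and their weak limit. -/

open scoped Classical in
/-- The uniform distribution on the points `σ ^ j x_w`, where `j ≤ k` and `w` is a word of length
`k + 1`. -/
noncomputable def orbitMeasure (hX : X.HasBoundedGaps N) (k : ℕ) : ProbabilityMeasure X.Pt :=
  haveI : Nonempty (X.words (k + 1)) := (hX.words_nonempty _).to_subtype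
  letI : MeasurableSpace (Fin (k + 1) × X.words (k + 1)) := ⊤
  ⟨((PMF.uniformOfFintype (Fin (k + 1) × X.words (k + 1))).toMeasure).map
    (fun p => X.shiftMap^[p.1] (hX.point p.2)),
    Measure.isProbabilityMeasure_map measurable_from_top.aemeasurable⟩

open scoped Classical in
theorem orbitMeasure_real (hX : X.HasBoundedGaps N) (k : ℕ) {S : Set X.Pt} (hS : MeasurableSet S) :
    (hX.orbitMeasure k : Measure X.Pt).real S =
      (∑ j ∈ Finset.range (k + 1), (hX.visitCount (k + 1) S j : ℝ)) /
        ((k + 1 : ℕ) * (X.words (k + 1)).ncard) := by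
  have : Nonempty (X.words (k + 1)) := (hX.words_nonempty _).to_subtype
  let : MeasurableSpace (Fin (k + 1) × X.words (k + 1)) := ⊤
  have hF : Measurable fun p : Fin (k + 1) × X.words (k + 1) =>
    X.shiftMap^[p.1] (hX.point p.2) := measurable_from_top
  have e : (hX.orbitMeasure k : Measure X.Pt) S =
      (PMF.uniformOfFintype (Fin (k + 1) × X.words (k + 1))).toMeasure
        ((fun p => X.shiftMap^[p.1] (hX.point p.2)) ⁻¹' S) := by
    simp only [orbitMeasure, ProbabilityMeasure.coe_mk]
    exact Measure.map_apply hF hS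
  rw [measureReal_def, e, PMF.toMeasure_uniformOfFintype_apply _ MeasurableSpace.measurableSet_top]
  rw [ENNReal.toReal_div]
  congr 1
  · rw [ENNReal.toReal_natCast, Fintype.card_subtype, Finset.card_filter, Fintype.sum_prod_type,
      ← Nat.cast_sum, ← Fin.sum_univ_eq_sum_range]
    congr 1
    refine Finset.sum_congr rfl fun j _ => ?_
    rw [visitCount, Finset.card_filter]
    rfl
  · rw [ENNReal.toReal_natCast, Fintype.card_prod, Fintype.card_fin, ← Nat.card_coe_set_eq,
      Nat.card_eq_fintype_card]
    push_cast
    rfl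

/-- Times at which the cylinder fits inside the word obey the exponential bound. At most `l` times
near the end do not, and the trivial bound there gives the error `l / (k + 1)`. -/
theorem orbitMeasure_cylinder_le (hX : X.HasBoundedGaps N) (k l : ℕ) (x : X.Pt) :
    (hX.orbitMeasure k : Measure X.Pt).real (X.cylinder (X.headWord l x)) ≤
      l / (k + 1 : ℕ) + gapConst n N ^ 2 * Real.exp (-(X.entropy * l)) := by
  rw [hX.orbitMeasure_real k (X.isClopen_cylinder _).isOpen.measurableSet]
  set L := k + 1 with hL
  have hL0 : (0 : ℝ) < L := by positivity
  have hc : (0 : ℝ) < (X.words L).ncard := by exact_mod_cast hX.ncard_words_pos L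
  rw [div_le_iff₀ (by positivity)]
  have h1 : ∀ j ∈ Finset.range L, (hX.visitCount L (X.cylinder (X.headWord l x)) j : ℝ) ≤
      gapConst n N ^ 2 * Real.exp (X.entropy * (L - l)) +
        if L < j + l then ((X.words L).ncard : ℝ) else 0 := by
    intro j _
    split_ifs with h
    · have : (hX.visitCount L (X.cylinder (X.headWord l x)) j : ℝ) ≤ (X.words L).ncard := by
        exact_mod_cast hX.visitCount_le _ _ _
      linarith [show 0 ≤ (gapConst n N : ℝ) ^ 2 * Real.exp (X.entropy * (L - l)) by positivity]
    · simpa using hX.visitCount_cylinder_le_exp (not_lt.1 h) x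
  have h2 := Finset.sum_le_sum h1
  rw [Finset.sum_add_distrib, Finset.sum_const, Finset.card_range, nsmul_eq_mul,
    ← Finset.sum_filter, Finset.sum_const, nsmul_eq_mul] at h2
  have h3 : (((Finset.range L).filter fun j => L < j + l).card : ℝ) ≤ l := by
    have : ((Finset.range L).filter fun j => L < j + l) ⊆ Finset.Ico (L - l) L := by
      intro j
      simp only [Finset.mem_filter, Finset.mem_range, Finset.mem_Ico]
      omega
    have := Finset.card_le_card this
    rw [Nat.card_Ico] at this
    exact_mod_cast this.trans (by omega)
  have h4 : Real.exp (X.entropy * (L - l)) ≤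
      Real.exp (-(X.entropy * l)) * (X.words L).ncard := by
    rw [show X.entropy * ((L : ℝ) - l) = -(X.entropy * l) + X.entropy * L by ring, Real.exp_add]
    exact mul_le_mul_of_nonneg_left (hX.exp_le_ncard_words L) (by positivity)
  calc _ ≤ _ := h2
    _ ≤ L * (gapConst n N ^ 2 * (Real.exp (-(X.entropy * l)) * (X.words L).ncard)) +
        l * (X.words L).ncard := by gcongr
    _ = _ := by field_simp; ring

/-- Only the `k + 1 - (l + 2 N)` times that leave room for both gaps are counted, whence the first
factor. -/
theorem le_orbitMeasure_cylinder (hX : X.HasBoundedGaps N) (k l : ℕ) (hk : l + 2 * N ≤ k + 1)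
    (x : X.Pt) :
    (1 - (l + 2 * N : ℕ) / (k + 1 : ℕ)) * (Real.exp (-(X.entropy * (2 * N))) /
      ((N + 1) ^ 2 * gapConst n N) * Real.exp (-(X.entropy * l))) ≤
      (hX.orbitMeasure k : Measure X.Pt).real (X.cylinder (X.headWord l x)) := by
  rw [hX.orbitMeasure_real k (X.isClopen_cylinder _).isOpen.measurableSet]
  set L := k + 1 with hL
  have hL0 : (0 : ℝ) < L := by positivity
  have hc : (0 : ℝ) < (X.words L).ncard := by exact_mod_cast hX.ncard_words_pos L
  have hK : (0 : ℝ) < gapConst n N := by exact_mod_cast hX.gapConst_pos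
  rw [le_div_iff₀ (by positivity)]
  have h1 : ((L : ℝ) - (l + 2 * N : ℕ)) * (Real.exp (X.entropy * (L - l - 2 * N)) / (N + 1) ^ 2) ≤
      ∑ j ∈ Finset.range L, (hX.visitCount L (X.cylinder (X.headWord l x)) j : ℝ) := by
    calc _ ≤ ∑ j ∈ Finset.Ico N (L - l - N),
          Real.exp (X.entropy * (L - l - 2 * N)) / (N + 1) ^ 2 := by
          rw [Finset.sum_const, nsmul_eq_mul, Nat.card_Ico]
          gcongr
          rw [← Nat.cast_sub hk]
          exact_mod_cast (by omega : L - (l + 2 * N) ≤ L - l - N - N)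
      _ ≤ ∑ j ∈ Finset.Ico N (L - l - N),
          (hX.visitCount L (X.cylinder (X.headWord l x)) j : ℝ) := by
          refine Finset.sum_le_sum fun j hj => ?_
          rw [Finset.mem_Ico] at hj
          rw [div_le_iff₀ (by positivity), mul_comm _ (((N : ℝ) + 1) ^ 2)]
          exact hX.exp_le_visitCount_cylinder (L := L) (l := l) hj.1 (by omega) x
      _ ≤ _ := by
          refine Finset.sum_le_sum_of_subset_of_nonneg ?_ fun _ _ _ => by positivity
          intro j
          simp only [Finset.mem_Ico, Finset.mem_range]
          omega
  refine le_trans ?_ h1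
  have h2 : (0 : ℝ) ≤ (L : ℝ) - (l + 2 * N : ℕ) := by
    rw [← Nat.cast_sub hk]
    positivity
  calc (1 - ((l + 2 * N : ℕ) : ℝ) / L) * (Real.exp (-(X.entropy * (2 * N))) /
      ((N + 1) ^ 2 * gapConst n N) * Real.exp (-(X.entropy * l))) * (L * (X.words L).ncard)
      = ((L : ℝ) - (l + 2 * N : ℕ)) * (Real.exp (-(X.entropy * (2 * N))) /
      ((N + 1) ^ 2 * gapConst n N) * Real.exp (-(X.entropy * l))) * (X.words L).ncard := by
        field_simp
    _ ≤ ((L : ℝ) - (l + 2 * N : ℕ)) * (Real.exp (-(X.entropy * (2 * N))) /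
      ((N + 1) ^ 2 * gapConst n N) * Real.exp (-(X.entropy * l))) *
        (gapConst n N * Real.exp (X.entropy * L)) := by
        gcongr
        exact hX.ncard_words_le_exp L
    _ = _ := by
        rw [show X.entropy * ((L : ℝ) - l - 2 * N) =
          -(X.entropy * (2 * N)) + -(X.entropy * l) + X.entropy * L by ring,
          Real.exp_add, Real.exp_add]
        field_simp

/-- The averages telescope: only the visits at the times `0` and `k + 1` survive. -/
theorem abs_orbitMeasure_preimage_sub_le (hX : X.HasBoundedGaps N) (k : ℕ) {S : Set X.Pt}
    (hS : MeasurableSet S) :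
    |(hX.orbitMeasure k : Measure X.Pt).real (X.shiftMap ⁻¹' S) -
      (hX.orbitMeasure k : Measure X.Pt).real S| ≤ 1 / (k + 1 : ℕ) := by
  have hc : (0 : ℝ) < (X.words (k + 1)).ncard := by exact_mod_cast hX.ncard_words_pos _
  rw [hX.orbitMeasure_real k hS,
    hX.orbitMeasure_real k (X.continuous_shiftMap.measurable hS), ← sub_div]
  simp only [visitCount_preimage_shiftMap]
  have h1 := Finset.sum_range_succ (fun j => (hX.visitCount (k + 1) S j : ℝ)) (k + 1)
  rw [Finset.sum_range_succ'] at h1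
  have h2 : (hX.visitCount (k + 1) S (k + 1) : ℝ) ≤ (X.words (k + 1)).ncard := by
    exact_mod_cast hX.visitCount_le _ _ _
  have h3 : (hX.visitCount (k + 1) S 0 : ℝ) ≤ (X.words (k + 1)).ncard := by
    exact_mod_cast hX.visitCount_le _ _ _
  rw [abs_div, abs_of_pos (show (0 : ℝ) < ((k + 1 : ℕ) : ℝ) * (X.words (k + 1)).ncard by positivity),
    div_le_div_iff₀ (by positivity) (by positivity), one_mul, mul_comm]
  gcongr
  rw [abs_le]
  constructor
  · linarith [Nat.cast_nonneg (α := ℝ) (hX.visitCount (k + 1) S (k + 1))]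
  · linarith [Nat.cast_nonneg (α := ℝ) (hX.visitCount (k + 1) S 0)]

/-- A weak limit of the orbit averages along an ultrafilter, which exists by compactness. Cylinders
are clopen, so their masses converge and the bounds pass to the limit. -/
theorem exists_isGibbs (hX : X.HasBoundedGaps N) : ∃ ν c C, X.IsGibbs ν c C := by
  have := hX.compactSpace
  have hU : (hyperfilter ℕ : Filter ℕ) ≤ atTop := Nat.hyperfilter_le_atTop
  set U := hyperfilter ℕ
  obtain ⟨ν, hν⟩ : ∃ ν, Tendsto hX.orbitMeasure U (𝓝 ν) :=
    ⟨_, (U.map hX.orbitMeasure).le_nhds_lim⟩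
  have hlim : ∀ S : Set X.Pt, IsClopen S → Tendsto
      (fun k => (hX.orbitMeasure k : Measure X.Pt).real S) U (𝓝 ((ν : Measure X.Pt).real S)) := by
    intro S hS
    have := ProbabilityMeasure.tendsto_measure_of_null_frontier_of_tendsto' hν (E := S)
      (by simp [hS.frontier_eq])
    exact (ENNReal.tendsto_toReal (measure_ne_top _ _)).comp this
  have hdiv : ∀ a : ℝ, Tendsto (fun k : ℕ => a / (k + 1 : ℕ)) U (𝓝 0) := fun a =>
    ((tendsto_const_div_atTop_nhds_zero_nat a).comp (tendsto_add_atTop_nat 1)).mono_left hU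
  have hK : (0 : ℝ) < gapConst n N := by exact_mod_cast hX.gapConst_pos
  refine ⟨ν, Real.exp (-(X.entropy * (2 * N))) / ((N + 1) ^ 2 * gapConst n N), gapConst n N ^ 2,
    ⟨X.continuous_shiftMap.measurable, ?_⟩, by positivity, fun k x => ?_, fun k x => ?_⟩
  · have hinv : ∀ S : Set X.Pt, IsClopen S →
        (ν : Measure X.Pt).real (X.shiftMap ⁻¹' S) = (ν : Measure X.Pt).real S := by
      intro S hS
      have h1 := ((hlim _ (hS.preimage X.continuous_shiftMap)).sub (hlim S hS)).abs
      have h2 := le_of_tendsto_of_tendsto' h1 (hdiv 1)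
        fun k => hX.abs_orbitMeasure_preimage_sub_le k hS.isOpen.measurableSet
      exact sub_eq_zero.1 (abs_nonpos_iff.1 h2)
    have : IsProbabilityMeasure ((ν : Measure X.Pt).map X.shiftMap) :=
      Measure.isProbabilityMeasure_map X.continuous_shiftMap.measurable.aemeasurable
    -- The clopen sets are a π-system generating the Borel σ-algebra.
    refine ext_of_generate_finite {S : Set X.Pt | IsClopen S} ?_ ?_ ?_ (by simp)
    · rw [← (isTopologicalBasis_isClopen (X := X.Pt)).borel_eq_generateFrom]
      exact BorelSpace.measurable_eq
    · exact fun s hs t ht _ => hs.inter ht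
    · intro S hS
      rw [Measure.map_apply X.continuous_shiftMap.measurable hS.isOpen.measurableSet]
      exact (measureReal_eq_measureReal_iff).1 (hinv S hS)
  · have h1 : Tendsto (fun j : ℕ => (1 - ((k + 2 * N : ℕ) : ℝ) / (j + 1 : ℕ)) *
        (Real.exp (-(X.entropy * (2 * N))) /
        ((N + 1) ^ 2 * gapConst n N) * Real.exp (-(X.entropy * k)))) U
        (𝓝 ((1 - 0) * (Real.exp (-(X.entropy * (2 * N))) /
        ((N + 1) ^ 2 * gapConst n N) * Real.exp (-(X.entropy * k))))) :=
      (tendsto_const_nhds.sub (hdiv _)).mul_const _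
    rw [sub_zero, one_mul] at h1
    refine le_of_tendsto_of_tendsto h1 (hlim _ (X.isClopen_cylinder _)) ?_
    filter_upwards [hU (eventually_ge_atTop (k + 2 * N))] with j hj
    exact hX.le_orbitMeasure_cylinder j k (by linarith [show k + 2 * N ≤ j from hj]) x
  · have h1 := (hdiv k).add_const ((gapConst n N : ℝ) ^ 2 * Real.exp (-(X.entropy * k)))
    rw [zero_add] at h1
    exact le_of_tendsto_of_tendsto' (hlim _ (X.isClopen_cylinder _)) h1
      fun j => hX.orbitMeasure_cylinder_le j k x

end HasBoundedGaps

end ShiftSpace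

/-! ### Ergodicity and uniqueness of the measure of maximal entropy -/

theorem measureReal_preimage_eq_sum {Ω ι : Type*} [MeasurableSpace Ω] [Fintype ι]
    (μ : Measure Ω) [IsFiniteMeasure μ] {f : Ω → ι} (hf : ∀ i, MeasurableSet (f ⁻¹' {i}))
    (S : Finset ι) : μ.real (f ⁻¹' S) = ∑ i ∈ S, μ.real (f ⁻¹' {i}) := by
  rw [← measureReal_biUnion_finset]
  · congr 1
    ext x
    simp
  · intro i _ j _ hij
    refine Set.disjoint_left.2 fun x hx hy => hij (Eq.trans (Eq.symm hx) hy)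
  · exact fun i _ => hf i

namespace ShiftSpace

variable {n : ℕ} {X : ShiftSpace n} {N : ℕ}

theorem measurableSet_headWord_fiber (X : ShiftSpace n) (k : ℕ) (w : Fin k → Fin n) :
    MeasurableSet (X.headWord k ⁻¹' {w}) := by
  rw [← cylinder_eq_preimage]
  exact (X.isClopen_cylinder w).isOpen.measurableSet

theorem measureEntropy_eq_limsup (μ : ProbabilityMeasure X.Pt) : X.measureEntropy μ =
    limsup (fun k : ℕ => shannonEntropy (μ : Measure X.Pt) (X.headWord k) / k) atTop := by
  simp only [measureEntropy, shannonEntropy, cylinder_eq_preimage]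

/-- A word of length `a + b` is a pair of words, and by invariance the second has the law of an
initial word of length `b`. -/
theorem subadditive_shannonEntropy {μ : ProbabilityMeasure X.Pt}
    (hμ : MeasurePreserving X.shiftMap (μ : Measure X.Pt) (μ : Measure X.Pt)) :
    Subadditive fun k => shannonEntropy (μ : Measure X.Pt) (X.headWord k) := by
  intro a b
  have e : X.headWord (a + b) = Fin.appendEquiv a b ∘
      fun x => (X.headWord a x, X.headWord b (X.shiftMap^[a] x)) := by
    funext x l
    refine Fin.addCases (fun i => ?_) (fun i => ?_) l
    · simp [headWord, Fin.appendEquiv]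
    · simp [headWord, Fin.appendEquiv, shiftMap_iterate_apply, add_comm]
  have hm : ∀ i, MeasurableSet ((fun x => X.headWord b (X.shiftMap^[a] x)) ⁻¹' {i}) := fun i =>
    (X.continuous_shiftMap.measurable.iterate a) (X.measurableSet_headWord_fiber b i)
  simp only
  rw [e, shannonEntropy_equiv]
  refine (shannonEntropy_prodMk_le (X.measurableSet_headWord_fiber a) hm).trans (le_of_eq ?_)
  congr 1
  unfold shannonEntropy
  refine Finset.sum_congr rfl fun i _ => ?_
  congr 1
  exact congrArg ENNReal.toReal ((hμ.iterate a).measure_preimage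
    (X.measurableSet_headWord_fiber b i).nullMeasurableSet)

theorem bddBelow_shannonEntropy (μ : ProbabilityMeasure X.Pt) : BddBelow (Set.range fun k : ℕ =>
    shannonEntropy (μ : Measure X.Pt) (X.headWord k) / k) :=
  ⟨0, by rintro _ ⟨k, rfl⟩; exact div_nonneg shannonEntropy_nonneg (Nat.cast_nonneg _)⟩

theorem tendsto_measureEntropy {μ : ProbabilityMeasure X.Pt}
    (hμ : MeasurePreserving X.shiftMap (μ : Measure X.Pt) (μ : Measure X.Pt)) :
    Tendsto (fun k : ℕ => shannonEntropy (μ : Measure X.Pt) (X.headWord k) / k) atTop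
      (𝓝 (X.measureEntropy μ)) := by
  have h := (subadditive_shannonEntropy hμ).tendsto_lim (bddBelow_shannonEntropy μ)
  rw [measureEntropy_eq_limsup]
  rwa [← h.limsup_eq] at h

theorem measureEntropy_mul_le {μ : ProbabilityMeasure X.Pt}
    (hμ : MeasurePreserving X.shiftMap (μ : Measure X.Pt) (μ : Measure X.Pt)) (k : ℕ) :
    X.measureEntropy μ * k ≤ shannonEntropy (μ : Measure X.Pt) (X.headWord k) := by
  rcases Nat.eq_zero_or_pos k with rfl | hk
  · simpa using shannonEntropy_nonneg
  · rw [← le_div_iff₀ (by exact_mod_cast hk), tendsto_nhds_unique (tendsto_measureEntropy hμ)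
      ((subadditive_shannonEntropy hμ).tendsto_lim (bddBelow_shannonEntropy μ))]
    exact (subadditive_shannonEntropy hμ).lim_le_div (bddBelow_shannonEntropy μ) hk.ne'

theorem HasBoundedGaps.measureEntropy_le (hX : X.HasBoundedGaps N) {μ : ProbabilityMeasure X.Pt}
    (hμ : MeasurePreserving X.shiftMap (μ : Measure X.Pt) (μ : Measure X.Pt)) :
    X.measureEntropy μ ≤ X.entropy := by
  classical
  refine le_of_tendsto_of_tendsto' (tendsto_measureEntropy hμ) hX.tendsto_entropy fun k => ?_
  gcongr
  rw [Set.ncard_eq_toFinset_card']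
  exact shannonEntropy_le_log_card (X.measurableSet_headWord_fiber k)
    fun x => by simpa using hX.headWord_mem k x

/-- The points that agree on `{-p, …, p - 1}` with a point of `K`. -/
def thickening (X : ShiftSpace n) (p : ℕ) (K : Set X.Pt) : Set X.Pt :=
  {y | ∃ x ∈ K, ∀ i : ℤ, -p ≤ i → i < p → y.1 i = x.1 i}

open scoped Classical in
/-- The words that the points of `K` carry at the coordinates `-p, …, p - 1`. -/
noncomputable def centralWords (X : ShiftSpace n) (p : ℕ) (K : Set X.Pt) :
    Finset (Fin (2 * p) → Fin n) :=
  Finset.univ.filter fun w => ∃ x ∈ K, ∀ l : Fin (2 * p), w l = x.1 ((l : ℕ) - p)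

/-- Thickenings use the window `[-p, p)`, cylinders start at `0`. Shifting `p` times passes from one
to the other, so invariant measures do not see the difference. -/
theorem preimage_iterate_thickening (p : ℕ) (K : Set X.Pt) :
    X.shiftMap^[p] ⁻¹' X.thickening p K = X.headWord (2 * p) ⁻¹' X.centralWords p K := by
  ext y
  simp only [thickening, centralWords, Set.mem_preimage, Set.mem_ofPred_eq, Finset.coe_filter,
    Finset.mem_univ, true_and, shiftMap_iterate_apply, headWord]
  refine exists_congr fun x => and_congr_right fun _ => ⟨fun h l => ?_, fun h i h1 h2 => ?_⟩
  · have := h ((l : ℕ) - p) (by omega) (by have := l.2; omega)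
    simpa using this
  · have := h ⟨(i + p).toNat, by omega⟩
    simp only [Int.toNat_of_nonneg (by omega : 0 ≤ i + p)] at this
    simpa using this

theorem subset_thickening (p : ℕ) (K : Set X.Pt) : K ⊆ X.thickening p K :=
  fun x hx => ⟨x, hx, fun _ _ _ => rfl⟩

theorem antitone_thickening (K : Set X.Pt) : Antitone fun p => X.thickening p K := by
  rintro p q hpq y ⟨x, hx, h⟩
  exact ⟨x, hx, fun i h1 h2 => h i (by omega) (by omega)⟩

theorem isOpen_thickening (p : ℕ) (K : Set X.Pt) : IsOpen (X.thickening p K) := by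
  have : X.thickening p K = ⋃ x ∈ K, ⋂ i ∈ Finset.Ico (-p : ℤ) p, {y : X.Pt | y.1 i = x.1 i} := by
    ext y
    simp [thickening]
  rw [this]
  refine isOpen_biUnion fun x _ => isOpen_biInter_finset fun i _ => ?_
  have hc : Continuous fun y : X.Pt => y.1 i := (continuous_apply i).comp continuous_subtype_val
  exact (isOpen_discrete {x.1 i}).preimage hc

theorem iInter_thickening {K : Set X.Pt} (hK : IsClosed K) : ⋂ p, X.thickening p K = K := by
  refine Set.Subset.antisymm (fun y hy => ?_) (Set.subset_iInter fun p => subset_thickening p K)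
  rw [Set.mem_iInter] at hy
  choose x hx h using hy
  refine hK.mem_of_tendsto (f := x) (b := atTop) ?_ (Eventually.of_forall hx)
  refine tendsto_subtype_rng.2 (tendsto_pi_nhds.2 fun i => tendsto_const_nhds.congr' ?_)
  filter_upwards [eventually_gt_atTop i.natAbs] with p hp
  exact h p i (by omega) (by omega)

theorem tendsto_measure_thickening (μ : ProbabilityMeasure X.Pt) {K : Set X.Pt} (hK : IsClosed K) :
    Tendsto (fun p => (μ : Measure X.Pt).real (X.thickening p K)) atTop
      (𝓝 ((μ : Measure X.Pt).real K)) := by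
  have h := tendsto_measure_iInter_atTop (μ := (μ : Measure X.Pt))
    (fun p => (isOpen_thickening p K).measurableSet.nullMeasurableSet) (antitone_thickening K)
    ⟨0, measure_ne_top _ _⟩
  rw [iInter_thickening hK] at h
  exact (ENNReal.tendsto_toReal (measure_ne_top _ _)).comp h

theorem measure_centralWords {μ : ProbabilityMeasure X.Pt}
    (hμ : MeasurePreserving X.shiftMap (μ : Measure X.Pt) (μ : Measure X.Pt)) (p : ℕ)
    (K : Set X.Pt) : (μ : Measure X.Pt).real (X.headWord (2 * p) ⁻¹' X.centralWords p K) =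
      (μ : Measure X.Pt).real (X.thickening p K) := by
  rw [← preimage_iterate_thickening]
  exact congrArg ENNReal.toReal ((hμ.iterate p).measure_preimage
    (isOpen_thickening p K).measurableSet.nullMeasurableSet)

/-! ### Correlation bounds, ergodicity, maximality and uniqueness. -/

namespace IsGibbs

variable {ν : ProbabilityMeasure X.Pt} {c C : ℝ}

theorem const_pos (hX : X.HasBoundedGaps N) (hν : X.IsGibbs ν c C) : 0 < C := by
  obtain ⟨x⟩ := hX.nonempty_pt
  have := (mul_pos hν.pos (Real.exp_pos _)).trans_le
    ((hν.le_measure 0 x).trans (hν.measure_le 0 x))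
  exact pos_of_mul_pos_left this (Real.exp_pos _).le

theorem measure_fiber_pos (hν : X.IsGibbs ν c C) (k : ℕ) (x : X.Pt) :
    0 < (ν : Measure X.Pt).real (X.headWord k ⁻¹' {X.headWord k x}) := by
  rw [← cylinder_eq_preimage]
  exact lt_of_lt_of_le (mul_pos hν.pos (Real.exp_pos _)) (hν.le_measure k x)

/-- A lower bound for the correlation of two cylinders. -/
theorem exists_le_measure_inter (hX : X.HasBoundedGaps N) (hν : X.IsGibbs ν c C) (k : ℕ)
    (x y : X.Pt) : ∃ g ∈ Finset.range (N + 1),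
    c * Real.exp (-(X.entropy * N)) * ((ν : Measure X.Pt).real (X.cylinder (X.headWord k x)) *
      (ν : Measure X.Pt).real (X.cylinder (X.headWord k y))) ≤
    C ^ 2 * (ν : Measure X.Pt).real (X.cylinder (X.headWord k x) ∩
      X.shiftMap^[k + g] ⁻¹' X.cylinder (X.headWord k y)) := by
  obtain ⟨g, hg, z, h1, h2⟩ := hX.glue_at x y k
  refine ⟨g, Finset.mem_range.2 (by omega), ?_⟩
  -- A single cylinder inside the intersection suffices: its length exceeds `2 k` by `g ≤ N`, which
  -- costs only the factor `exp (-h N)`.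
  have hsub : X.cylinder (X.headWord (k + g + k) z) ⊆ X.cylinder (X.headWord k x) ∩
      X.shiftMap^[k + g] ⁻¹' X.cylinder (X.headWord k y) := by
    intro t ht
    simp only [Set.mem_inter_iff, Set.mem_preimage, mem_cylinder_headWord,
      shiftMap_iterate_apply] at ht ⊢
    refine ⟨fun i h0 hi => ?_, fun i h0 hi => ?_⟩
    · rw [ht i h0 (by omega), h1 i hi]
    · rw [ht _ (by omega) (by omega), ← h2 i h0]
      push_cast
      ring_nf
  have hC : 0 < C := hν.const_pos hX
  have h3 : (ν : Measure X.Pt).real (X.cylinder (X.headWord k x)) *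
      (ν : Measure X.Pt).real (X.cylinder (X.headWord k y)) ≤
      (C * Real.exp (-(X.entropy * k))) * (C * Real.exp (-(X.entropy * k))) :=
    mul_le_mul (hν.measure_le k x) (hν.measure_le k y) measureReal_nonneg (by positivity)
  calc c * Real.exp (-(X.entropy * N)) * ((ν : Measure X.Pt).real (X.cylinder (X.headWord k x)) *
      (ν : Measure X.Pt).real (X.cylinder (X.headWord k y)))
      ≤ c * Real.exp (-(X.entropy * N)) *
        ((C * Real.exp (-(X.entropy * k))) * (C * Real.exp (-(X.entropy * k)))) :=
        mul_le_mul_of_nonneg_left h3 (mul_nonneg hν.pos.le (Real.exp_pos _).le)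
    _ = C ^ 2 * (c * Real.exp (-(X.entropy * (k + N + k)))) := by
        rw [show -(X.entropy * ((k : ℝ) + N + k)) =
          -(X.entropy * k) + -(X.entropy * N) + -(X.entropy * k) by ring, Real.exp_add,
          Real.exp_add]
        ring
    _ ≤ C ^ 2 * (c * Real.exp (-(X.entropy * (k + g + k : ℕ)))) := by
        have hc := hν.pos
        have hh := hX.entropy_nonneg
        push_cast
        gcongr
    _ ≤ _ := by
        gcongr
        exact (hν.le_measure _ z).trans (measureReal_mono hsub)

/-- The gap depends on the pair of words, so after summing over pairs only the total correlation
over all gaps is bounded below. -/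
theorem mul_le_sum_measure_inter (hX : X.HasBoundedGaps N) (hν : X.IsGibbs ν c C) (k : ℕ)
    (S S' : Finset (Fin k → Fin n)) :
    c * Real.exp (-(X.entropy * N)) * ((ν : Measure X.Pt).real (X.headWord k ⁻¹' S) *
      (ν : Measure X.Pt).real (X.headWord k ⁻¹' S')) ≤
    C ^ 2 * ∑ g ∈ Finset.range (N + 1), (ν : Measure X.Pt).real (X.headWord k ⁻¹' S ∩
      X.shiftMap^[k + g] ⁻¹' (X.headWord k ⁻¹' S')) := by
  have e : ∀ g, (ν : Measure X.Pt).real (X.headWord k ⁻¹' S ∩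
      X.shiftMap^[k + g] ⁻¹' (X.headWord k ⁻¹' S')) = ∑ z ∈ S ×ˢ S',
      (ν : Measure X.Pt).real (X.cylinder z.1 ∩ X.shiftMap^[k + g] ⁻¹' X.cylinder z.2) := by
    intro g
    have h := measureReal_preimage_eq_sum (ν : Measure X.Pt)
      (f := fun x => (X.headWord k x, X.headWord k (X.shiftMap^[k + g] x)))
      (fun z => by
        rw [fiber_prodMk]
        exact (X.measurableSet_headWord_fiber k _).inter
          ((X.continuous_shiftMap.measurable.iterate _) (X.measurableSet_headWord_fiber k _)))
      (S ×ˢ S')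
    simp only [fiber_prodMk] at h
    simp only [cylinder_eq_preimage]
    refine Eq.trans ?_ (h.trans rfl)
    congr 1
    ext x
    simp
  simp only [e]
  rw [Finset.sum_comm, measureReal_preimage_eq_sum _ (X.measurableSet_headWord_fiber k),
    measureReal_preimage_eq_sum _ (X.measurableSet_headWord_fiber k), Finset.sum_mul_sum,
    ← Finset.sum_product', Finset.mul_sum, Finset.mul_sum]
  refine Finset.sum_le_sum fun z _ => ?_
  have hr : 0 ≤ C ^ 2 * ∑ g ∈ Finset.range (N + 1),
      (ν : Measure X.Pt).real (X.cylinder z.1 ∩ X.shiftMap^[k + g] ⁻¹' X.cylinder z.2) := by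
    have := Finset.sum_nonneg fun g (_ : g ∈ Finset.range (N + 1)) => measureReal_nonneg
      (μ := (ν : Measure X.Pt)) (s := X.cylinder z.1 ∩ X.shiftMap^[k + g] ⁻¹' X.cylinder z.2)
    positivity
  by_cases h1 : ∃ x, X.headWord k x = z.1
  · by_cases h2 : ∃ y, X.headWord k y = z.2
    · obtain ⟨x, hx⟩ := h1
      obtain ⟨y, hy⟩ := h2
      obtain ⟨g, hg, h⟩ := hν.exists_le_measure_inter hX k x y
      rw [hx, hy] at h
      simp only [← cylinder_eq_preimage]
      refine h.trans ?_
      gcongr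
      exact Finset.single_le_sum (f := fun g => (ν : Measure X.Pt).real (X.cylinder z.1 ∩
        X.shiftMap^[k + g] ⁻¹' X.cylinder z.2)) (fun _ _ => measureReal_nonneg) hg
    · have : X.headWord k ⁻¹' {z.2} = ∅ := by
        ext y
        simpa using fun h => h2 ⟨y, h⟩
      simpa [this] using hr
  · have : X.headWord k ⁻¹' {z.1} = ∅ := by
      ext y
      simpa using fun h => h1 ⟨y, h⟩
    simpa [this] using hr

/-- Suppose an invariant set and its complement both have positive mass, and take closed sets `K`,
`K'` of positive mass in them. The correlations of their thickenings are bounded below, but no orbit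
joins `K` to `K'`, so these correlations are at most the masses added by thickening, which tend to
`0`. -/
theorem ergodic (hX : X.HasBoundedGaps N) (hν : X.IsGibbs ν c C) :
    Ergodic X.shiftMap (ν : Measure X.Pt) := by
  refine ⟨hν.measurePreserving, ⟨fun A hA hinv => ?_⟩⟩
  by_contra hcon
  rw [eventuallyConst_set', not_or, ae_eq_empty, ae_eq_univ] at hcon
  obtain ⟨K, hKA, hK, hK0⟩ := hA.exists_lt_isClosed_of_ne_top (measure_ne_top _ _)
    (pos_iff_ne_zero.2 hcon.1)
  obtain ⟨K', hKA', hK', hK0'⟩ := hA.compl.exists_lt_isClosed_of_ne_top (measure_ne_top _ _)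
    (pos_iff_ne_zero.2 hcon.2)
  have hpos : 0 < (ν : Measure X.Pt).real K := ENNReal.toReal_pos hK0.ne' (measure_ne_top _ _)
  have hpos' : 0 < (ν : Measure X.Pt).real K' := ENNReal.toReal_pos hK0'.ne' (measure_ne_top _ _)
  have hiter : ∀ t, X.shiftMap^[t] ⁻¹' A = A := by
    intro t
    induction t with
    | zero => simp
    | succ t ih => rw [Function.iterate_succ, Set.preimage_comp, ih, hinv]
  have hmeas : ∀ t, Measurable X.shiftMap^[t] := X.continuous_shiftMap.measurable.iterate
  have hbound : ∀ p, c * Real.exp (-(X.entropy * N)) * ((ν : Measure X.Pt).real K *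
      (ν : Measure X.Pt).real K') ≤ C ^ 2 * ∑ g ∈ Finset.range (N + 1),
        (((ν : Measure X.Pt).real (X.thickening p K) - (ν : Measure X.Pt).real K) +
          ((ν : Measure X.Pt).real (X.thickening p K') - (ν : Measure X.Pt).real K')) := by
    intro p
    have h := hν.mul_le_sum_measure_inter hX (2 * p) (X.centralWords p K) (X.centralWords p K')
    rw [measure_centralWords hν.measurePreserving, measure_centralWords hν.measurePreserving] at h
    refine le_trans ?_ (h.trans ?_)
    · have hc := hν.pos
      have h1 := measureReal_mono (μ := (ν : Measure X.Pt)) (subset_thickening p K)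
      have h2 := measureReal_mono (μ := (ν : Measure X.Pt)) (subset_thickening p K')
      gcongr
    · gcongr with g hg
      rw [← preimage_iterate_thickening, ← preimage_iterate_thickening]
      have hsub : X.shiftMap^[p] ⁻¹' X.thickening p K ∩
          X.shiftMap^[2 * p + g] ⁻¹' (X.shiftMap^[p] ⁻¹' X.thickening p K') ⊆
          X.shiftMap^[p] ⁻¹' (X.thickening p K \ K) ∪
          X.shiftMap^[2 * p + g] ⁻¹' (X.shiftMap^[p] ⁻¹' (X.thickening p K' \ K')) := by
        rintro x ⟨hx, hx'⟩
        by_cases h1 : X.shiftMap^[p] x ∈ K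
        · right
          refine ⟨hx', fun h2 => ?_⟩
          have h3 : x ∈ A := by
            rw [← hiter p]
            exact hKA h1
          have h4 : X.shiftMap^[2 * p + g] x ∈ A := by
            have : x ∈ X.shiftMap^[2 * p + g] ⁻¹' A := by rwa [hiter]
            exact this
          have h5 : X.shiftMap^[p] (X.shiftMap^[2 * p + g] x) ∈ A := by
            have : X.shiftMap^[2 * p + g] x ∈ X.shiftMap^[p] ⁻¹' A := by rwa [hiter]
            exact this
          exact hKA' h2 h5
        · exact Or.inl ⟨hx, h1⟩
      have hd : ∀ F : Set X.Pt, IsClosed F →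
          (ν : Measure X.Pt).real (X.shiftMap^[p] ⁻¹' (X.thickening p F \ F)) =
          (ν : Measure X.Pt).real (X.thickening p F) - (ν : Measure X.Pt).real F := by
        intro F hF
        rw [← measureReal_sdiff (subset_thickening p F) hF.measurableSet]
        exact congrArg ENNReal.toReal ((hν.measurePreserving.iterate p).measure_preimage
          ((isOpen_thickening p F).measurableSet.diff hF.measurableSet).nullMeasurableSet)
      have hd' : (ν : Measure X.Pt).real
          (X.shiftMap^[2 * p + g] ⁻¹' (X.shiftMap^[p] ⁻¹' (X.thickening p K' \ K'))) =
          (ν : Measure X.Pt).real (X.shiftMap^[p] ⁻¹' (X.thickening p K' \ K')) :=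
        congrArg ENNReal.toReal ((hν.measurePreserving.iterate _).measure_preimage
          (hmeas p ((isOpen_thickening p K').measurableSet.diff
            hK'.measurableSet)).nullMeasurableSet)
      refine (measureReal_mono hsub).trans ((measureReal_union_le _ _).trans (le_of_eq ?_))
      rw [hd', hd K hK, hd K' hK']
  have hlim : Tendsto (fun p => C ^ 2 * ∑ g ∈ Finset.range (N + 1),
      (((ν : Measure X.Pt).real (X.thickening p K) - (ν : Measure X.Pt).real K) +
        ((ν : Measure X.Pt).real (X.thickening p K') - (ν : Measure X.Pt).real K'))) atTop
      (𝓝 (C ^ 2 * ∑ g ∈ Finset.range (N + 1),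
      (((ν : Measure X.Pt).real K - (ν : Measure X.Pt).real K) +
        ((ν : Measure X.Pt).real K' - (ν : Measure X.Pt).real K')))) :=
    (tendsto_finsetSum _ fun g _ => ((tendsto_measure_thickening ν hK).sub_const _).add
      ((tendsto_measure_thickening ν hK').sub_const _)).const_mul _
  have h := ge_of_tendsto' hlim hbound
  simp only [sub_self, add_zero, Finset.sum_const_zero, mul_zero] at h
  exact absurd h (not_le.2 (mul_pos (mul_pos hν.pos (Real.exp_pos _)) (mul_pos hpos hpos')))

/-- The upper Gibbs bound gives every word of length `k` information at least `k h - log C`. -/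
theorem mem_maxMeasures (hX : X.HasBoundedGaps N) (hν : X.IsGibbs ν c C) : ν ∈ X.maxMeasures := by
  refine ⟨hν.measurePreserving, le_antisymm (hX.measureEntropy_le hν.measurePreserving) ?_⟩
  have hC : 0 < C := hν.const_pos hX
  have hlow : ∀ k : ℕ, X.entropy * k - Real.log C ≤
      shannonEntropy (ν : Measure X.Pt) (X.headWord k) := by
    intro k
    have h1 : ∀ w, (ν : Measure X.Pt).real (X.headWord k ⁻¹' {w}) *
        (X.entropy * k - Real.log C) ≤
        Real.negMulLog ((ν : Measure X.Pt).real (X.headWord k ⁻¹' {w})) := by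
      intro w
      by_cases hw : ∃ x, X.headWord k x = w
      · obtain ⟨x, rfl⟩ := hw
        have hp := hν.measure_fiber_pos k x
        have h2 := hν.measure_le k x
        rw [cylinder_eq_preimage] at h2
        have h3 := Real.log_le_log hp h2
        rw [Real.log_mul hC.ne' (Real.exp_pos _).ne', Real.log_exp] at h3
        simp only [Real.negMulLog]
        nlinarith
      · have : X.headWord k ⁻¹' {w} = ∅ := by
          ext y
          simpa using fun h => hw ⟨y, h⟩
        simp [this]
    have h2 := Finset.sum_le_sum fun w (_ : w ∈ Finset.univ) => h1 w
    rwa [← Finset.sum_mul, sum_measureReal_fiber _ (X.measurableSet_headWord_fiber k),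
      one_mul] at h2
  have hlim : Tendsto (fun k : ℕ => X.entropy - Real.log C / k) atTop (𝓝 (X.entropy - 0)) :=
    tendsto_const_nhds.sub (tendsto_const_div_atTop_nhds_zero_nat _)
  rw [sub_zero] at hlim
  refine le_of_tendsto_of_tendsto hlim (tendsto_measureEntropy hν.measurePreserving) ?_
  filter_upwards [eventually_gt_atTop 0] with k hk
  have hk' : (0 : ℝ) < k := by exact_mod_cast hk
  rw [le_div_iff₀ hk', sub_mul, div_mul_cancel₀ _ hk'.ne']
  exact hlow k

/-- The Gibbs inequality for the measure `ν`, reweighted on a set of words. -/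
theorem shannonEntropy_le (hν : X.IsGibbs ν c C) (η : ProbabilityMeasure X.Pt) (k : ℕ)
    (S : Finset (Fin k → Fin n)) :
    shannonEntropy (η : Measure X.Pt) (X.headWord k) ≤ X.entropy * k - Real.log c + Real.log 2 +
      (η : Measure X.Pt).real (X.headWord k ⁻¹' S) *
        Real.log ((ν : Measure X.Pt).real (X.headWord k ⁻¹' S)) := by
  classical
  set ηw : (Fin k → Fin n) → ℝ := fun w => (η : Measure X.Pt).real (X.headWord k ⁻¹' {w}) with hηw
  set νw : (Fin k → Fin n) → ℝ := fun w => (ν : Measure X.Pt).real (X.headWord k ⁻¹' {w}) with hνw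
  set νS := (ν : Measure X.Pt).real (X.headWord k ⁻¹' S) with hνS
  have hsumS : νS = ∑ w ∈ S, νw w :=
    measureReal_preimage_eq_sum _ (X.measurableSet_headWord_fiber k) S
  have hsum1 : ∑ w, νw w = 1 := sum_measureReal_fiber _ (X.measurableSet_headWord_fiber k)
  have hν0 : ∀ w, 0 ≤ νw w := fun w => measureReal_nonneg
  have hη0 : ∀ w, 0 ≤ ηw w := fun w => measureReal_nonneg
  have hνS0 : 0 ≤ νS := measureReal_nonneg
  have hpos : ∀ w, ηw w ≠ 0 → c * Real.exp (-(X.entropy * k)) ≤ νw w := by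
    intro w hw
    by_cases h : ∃ x, X.headWord k x = w
    · obtain ⟨x, rfl⟩ := h
      simpa only [hνw, cylinder_eq_preimage] using hν.le_measure k x
    · have : X.headWord k ⁻¹' {w} = ∅ := by
        ext y
        simpa using fun h' => h ⟨y, h'⟩
      simp [hηw, this] at hw
  have hce : 0 < c * Real.exp (-(X.entropy * k)) := mul_pos hν.pos (Real.exp_pos _)
  have hSpos : ∀ w ∈ S, ηw w ≠ 0 → 0 < νS := by
    intro w hwS hw
    rw [hsumS]
    exact (hce.trans_le (hpos w hw)).trans_le
      (Finset.single_le_sum (fun w _ => hν0 w) hwS)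
  -- The reference weights are half of `ν` conditioned on `S`, and half of `ν` off `S`. Halving
  -- keeps the total at most `1` and produces `log 2`; conditioning produces the term in `log νS`.
  have h := sum_negMulLog_le (p := ηw)
    (q := fun w => νw w / 2 * if w ∈ S then νS⁻¹ else 1) hη0
    (fun w => by
      have := hν0 w
      split_ifs <;> positivity)
    (sum_measureReal_fiber _ (X.measurableSet_headWord_fiber k))
    (by
      have h1 : ∀ w, (νw w / 2 * if w ∈ S then νS⁻¹ else 1) ≤
          (if w ∈ S then νw w * νS⁻¹ / 2 else 0) + νw w / 2 := by
        intro w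
        have := hν0 w
        split_ifs
        · linarith
        · linarith
      refine (Finset.sum_le_sum fun w _ => h1 w).trans ?_
      rw [Finset.sum_add_distrib, ← Finset.sum_div, hsum1, Finset.sum_ite_mem, Finset.univ_inter,
        ← Finset.sum_div, ← Finset.sum_mul, ← hsumS]
      have : νS * νS⁻¹ ≤ 1 := mul_inv_le_one
      linarith)
    (fun w hw => by
      by_contra hne
      have h1 := hce.trans_le (hpos w hne)
      by_cases hwS : w ∈ S
      · have h2 := hSpos w hwS hne
        simp [hwS, h1.ne', h2.ne'] at hw
      · simp [hwS, h1.ne'] at hw)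
  refine h.trans ?_
  have hterm : ∀ w, ηw w * (-Real.log (νw w / 2 * if w ∈ S then νS⁻¹ else 1)) ≤
      ηw w * (X.entropy * k - Real.log c + Real.log 2) +
        if w ∈ S then ηw w * Real.log νS else 0 := by
    intro w
    by_cases hne : ηw w = 0
    · simp [hne]
    have h1 := hce.trans_le (hpos w hne)
    have h2 := Real.log_le_log hce (hpos w hne)
    rw [Real.log_mul hν.pos.ne' (Real.exp_pos _).ne', Real.log_exp] at h2
    by_cases hwS : w ∈ S
    · have h3 := hSpos w hwS hne
      simp only [hwS, if_true]
      rw [Real.log_mul (by positivity) (by positivity), Real.log_div h1.ne' (by norm_num),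
        Real.log_inv, ← mul_add]
      exact mul_le_mul_of_nonneg_left (by linarith) (hη0 w)
    · simp only [hwS, if_false, mul_one, add_zero]
      rw [Real.log_div h1.ne' (by norm_num)]
      exact mul_le_mul_of_nonneg_left (by linarith) (hη0 w)
  refine (Finset.sum_le_sum fun w _ => hterm w).trans (le_of_eq ?_)
  rw [Finset.sum_add_distrib, ← Finset.sum_mul, Finset.sum_ite_mem, Finset.univ_inter,
    ← Finset.sum_mul, sum_measureReal_fiber _ (X.measurableSet_headWord_fiber k), one_mul,
    measureReal_preimage_eq_sum _ (X.measurableSet_headWord_fiber k) S]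

/-- Take a closed `K` with `η K > 0 = ν K` and apply `shannonEntropy_le` to its thickenings. Maximal
entropy cancels the linear terms and leaves `η K * log (ν (X.thickening p K)) ≥ log c - log 2`,
although these `ν`-masses tend to `0`. -/
theorem absolutelyContinuous (hX : X.HasBoundedGaps N) (hν : X.IsGibbs ν c C) {η : ProbabilityMeasure X.Pt}
    (hη : η ∈ X.maxMeasures) : (η : Measure X.Pt) ≪ (ν : Measure X.Pt) := by
  refine Measure.AbsolutelyContinuous.mk fun s hs hs0 => ?_
  by_contra hcon
  obtain ⟨K, hKs, hK, hK0⟩ := hs.exists_lt_isClosed_of_ne_top (measure_ne_top _ _)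
    (pos_iff_ne_zero.2 hcon)
  have ha : 0 < (η : Measure X.Pt).real K := ENNReal.toReal_pos hK0.ne' (measure_ne_top _ _)
  have hνK : (ν : Measure X.Pt).real K = 0 := by
    rw [measureReal_def, measure_mono_null hKs hs0, ENNReal.toReal_zero]
  have hlim := tendsto_measure_thickening ν hK
  rw [hνK] at hlim
  obtain ⟨x, hx⟩ := nonempty_of_measure_ne_zero hK0.ne'
  refine absurd (ge_of_tendsto' (b := Real.exp ((Real.log c - Real.log 2) /
    (η : Measure X.Pt).real K)) hlim fun p => ?_) (not_le.2 (Real.exp_pos _))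
  have h1 := hν.shannonEntropy_le η (2 * p) (X.centralWords p K)
  have h2 := measureEntropy_mul_le hη.1 (2 * p)
  rw [hη.2] at h2
  rw [measure_centralWords hη.1, measure_centralWords hν.measurePreserving] at h1
  have hpos : 0 < (ν : Measure X.Pt).real (X.thickening p K) := by
    rw [← measure_centralWords hν.measurePreserving,
      ← preimage_iterate_thickening]
    refine (hν.measure_fiber_pos (2 * p) (hX.translate (-p) x)).trans_le (measureReal_mono ?_)
    intro y hy
    rw [← cylinder_eq_preimage, mem_cylinder_headWord] at hy
    refine ⟨x, hx, fun i h1 h2 => ?_⟩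
    rw [shiftMap_iterate_apply, hy (i + p) (by omega) (by push_cast; omega)]
    simp
  have h3 : (η : Measure X.Pt).real K ≤ (η : Measure X.Pt).real (X.thickening p K) :=
    measureReal_mono (subset_thickening p K)
  have h4 : Real.log ((ν : Measure X.Pt).real (X.thickening p K)) ≤ 0 :=
    Real.log_nonpos hpos.le measureReal_le_one
  rw [← Real.le_log_iff_exp_le hpos, div_le_iff₀ ha]
  nlinarith

/-- An invariant probability measure absolutely continuous with respect to an ergodic one equals it.
-/
theorem maxMeasures_eq (hX : X.HasBoundedGaps N) (hν : X.IsGibbs ν c C) :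
    X.maxMeasures = {ν} := by
  refine Set.Subset.antisymm (fun η hη => ?_) (by simpa using hν.mem_maxMeasures hX)
  have h : (η : Measure X.Pt) = ν :=
    (hν.ergodic hX).eq_of_absolutelyContinuous hη.1 (hν.absolutelyContinuous hX hη)
  exact Subtype.ext h

end IsGibbs

end ShiftSpace

/-! ### The Hausdorff dimension of a shift space with bounded gaps -/

namespace ShiftSpace

variable {n : ℕ} {X : ShiftSpace n} {N : ℕ}

/-- The full shift, as an extended metric space. -/
def MetricShift (n : ℕ) : Type := ℤ → Fin n

noncomputable instance (n : ℕ) : EMetricSpace (MetricShift n) := fullShiftMetric n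

noncomputable instance (n : ℕ) : MeasurableSpace (MetricShift n) := borel _

instance (n : ℕ) : BorelSpace (MetricShift n) := ⟨rfl⟩

namespace MetricShift

theorem edist_def (x y : MetricShift n) : edist x y = ∑' i : ℤ,
    ENNReal.ofReal (|((x i : ℕ) : ℝ) - ((y i : ℕ) : ℝ)| / (n : ℝ) ^ (i.natAbs + 1)) := rfl

/-- Each of the two tails of the series is dominated by a geometric one of ratio `1 / n ≤ 1 / 2`,
hence is at most `2 n ^ (-p)`. -/
theorem edist_le (hn : 2 ≤ n) {x y : MetricShift n} {p : ℕ}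
    (h : ∀ i : ℤ, -p ≤ i → i < p → x i = y i) :
    edist x y ≤ ENNReal.ofReal (4 * ((n : ℝ)⁻¹) ^ p) := by
  have hn0 : (0 : ℝ) < n := by exact_mod_cast (by omega : 0 < n)
  have hn2 : (2 : ℝ) ≤ n := by exact_mod_cast hn
  set f : ℤ → ENNReal := fun i =>
    ENNReal.ofReal (|((x i : ℕ) : ℝ) - ((y i : ℕ) : ℝ)| / (n : ℝ) ^ (i.natAbs + 1)) with hf
  have hterm : ∀ i : ℤ, f i ≤ ENNReal.ofReal (((n : ℝ)⁻¹) ^ i.natAbs) := by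
    intro i
    refine ENNReal.ofReal_le_ofReal ?_
    rw [div_le_iff₀ (by positivity), inv_pow, pow_succ, inv_mul_cancel_left₀ (by positivity)]
    have h1 : ((x i : ℕ) : ℝ) ≤ n := by exact_mod_cast (x i).2.le
    have h2 : ((y i : ℕ) : ℝ) ≤ n := by exact_mod_cast (y i).2.le
    rw [abs_le]
    constructor <;> linarith [Nat.cast_nonneg (α := ℝ) (x i : ℕ), Nat.cast_nonneg (α := ℝ) (y i : ℕ)]
  have hzero : ∀ i : ℤ, -p ≤ i → i < p → f i = 0 := by
    intro i h1 h2
    simp [hf, h i h1 h2]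
  have hgeom : ∀ g : ℕ → ENNReal, (∀ j < p, g j = 0) →
      (∀ j, g j ≤ ENNReal.ofReal (((n : ℝ)⁻¹) ^ j)) →
      ∑' j, g j ≤ ENNReal.ofReal (2 * ((n : ℝ)⁻¹) ^ p) := by
    intro g hg0 hg
    rw [← ENNReal.summable.sum_add_tsum_nat_add' (k := p),
      Finset.sum_eq_zero fun j hj => hg0 j (Finset.mem_range.1 hj), zero_add]
    have hinv : (n : ℝ)⁻¹ ≤ 1 / 2 := by
      rw [one_div]
      exact inv_anti₀ (by norm_num) hn2
    have hsum : HasSum (fun j => ((n : ℝ)⁻¹) ^ (j + p)) ((1 - (n : ℝ)⁻¹)⁻¹ * ((n : ℝ)⁻¹) ^ p) := by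
      simp only [pow_add]
      exact (hasSum_geometric_of_lt_one (by positivity) (by linarith)).mul_right _
    calc ∑' j, g (j + p) ≤ ∑' j, ENNReal.ofReal (((n : ℝ)⁻¹) ^ (j + p)) :=
          ENNReal.tsum_le_tsum fun j => hg _
      _ = ENNReal.ofReal ((1 - (n : ℝ)⁻¹)⁻¹ * ((n : ℝ)⁻¹) ^ p) := by
          rw [← ENNReal.ofReal_tsum_of_nonneg (fun j => by positivity) hsum.summable, hsum.tsum_eq]
      _ ≤ _ := by
          refine ENNReal.ofReal_le_ofReal ?_
          gcongr
          rw [inv_le_comm₀ (by linarith) (by norm_num)]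
          linarith
  have hs := (HasSum.of_nat_of_neg_add_one (f := f) ENNReal.summable.hasSum
    ENNReal.summable.hasSum).tsum_eq
  rw [edist_def]
  change ∑' i, f i ≤ _
  rw [hs, show (4 : ℝ) * ((n : ℝ)⁻¹) ^ p = 2 * ((n : ℝ)⁻¹) ^ p + 2 * ((n : ℝ)⁻¹) ^ p by ring,
    ENNReal.ofReal_add (by positivity) (by positivity)]
  refine add_le_add (hgeom _ (fun j hj => hzero _ (by omega) (by omega)) fun j => ?_)
    (hgeom _ (fun j hj => hzero _ (by omega) (by omega)) fun j => ?_)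
  · simpa using hterm j
  · refine (hterm _).trans (ENNReal.ofReal_le_ofReal ?_)
    exact pow_le_pow_of_le_one (by positivity) (inv_le_one_of_one_le₀ (by linarith)) (by omega)

/-- A disagreement at `i` alone contributes at least `n ^ (-|i| - 1)`, and `|i| ≤ p` in the window.
-/
theorem eq_of_edist_lt {x y : MetricShift n} {p : ℕ}
    (h : edist x y < ENNReal.ofReal (((n : ℝ)⁻¹) ^ (p + 1))) {i : ℤ} (h1 : -p ≤ i) (h2 : i < p) :
    x i = y i := by
  by_contra hne
  refine absurd h (not_lt.2 ?_)
  have hn1 : (1 : ℝ) ≤ n := by exact_mod_cast Fin.pos (x i)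
  rw [edist_def]
  refine le_trans (ENNReal.ofReal_le_ofReal ?_) (ENNReal.le_tsum i)
  have h3 : (1 : ℝ) ≤ |((x i : ℕ) : ℝ) - ((y i : ℕ) : ℝ)| := by
    have : (1 : ℤ) ≤ |((x i : ℕ) : ℤ) - ((y i : ℕ) : ℤ)| :=
      Int.one_le_abs (sub_ne_zero.2 fun h => hne (Fin.ext (by exact_mod_cast h)))
    exact_mod_cast this
  rw [inv_pow, ← one_div]
  gcongr
  omega

theorem continuous_of (hn : 2 ≤ n) :
    Continuous fun x : ℤ → Fin n => (show MetricShift n from x) := by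
  rw [continuous_iff_continuousAt]
  intro x
  rw [ContinuousAt, EMetric.tendsto_nhds]
  intro ε hε
  have hn2 : (2 : ℝ) ≤ n := by exact_mod_cast hn
  have hlim : Tendsto (fun p : ℕ => ENNReal.ofReal (4 * ((n : ℝ)⁻¹) ^ p)) atTop (𝓝 0) := by
    have := (tendsto_pow_atTop_nhds_zero_of_lt_one (r := (n : ℝ)⁻¹) (by positivity)
      (inv_lt_one_of_one_lt₀ (by linarith))).const_mul 4
    simpa using ENNReal.tendsto_ofReal this
  obtain ⟨p, hp⟩ := (hlim.eventually (gt_mem_nhds hε)).exists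
  have hopen : IsOpen (⋂ i ∈ Finset.Ico (-p : ℤ) p, {y : ℤ → Fin n | y i = x i}) :=
    isOpen_biInter_finset fun i _ => by
      have hc : Continuous fun y : ℤ → Fin n => y i := continuous_apply i
      exact (isOpen_discrete {x i}).preimage hc
  filter_upwards [hopen.mem_nhds (by simp)] with y hy
  refine lt_of_le_of_lt (edist_le hn fun i h1 h2 => ?_) hp
  simp only [Set.mem_iInter, Finset.mem_Ico] at hy
  exact hy i ⟨h1, h2⟩

theorem isOpen_centralCylinder (x : MetricShift n) (p : ℕ) :
    IsOpen {y : MetricShift n | ∀ i : ℤ, -p ≤ i → i < p → y i = x i} := by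
  rw [EMetric.isOpen_iff]
  intro y hy
  have hn : (0 : ℝ) < n := by exact_mod_cast Fin.pos (x 0)
  refine ⟨ENNReal.ofReal (((n : ℝ)⁻¹) ^ (p + 1)), ENNReal.ofReal_pos.2 (by positivity),
    fun z hz i h1 h2 => ?_⟩
  rw [eq_of_edist_lt (Metric.mem_eball.1 hz) h1 h2, hy i h1 h2]

end MetricShift

/-- The points of a shift space, as a subset of the metric space. -/
def metricCarrier (X : ShiftSpace n) : Set (MetricShift n) := X.carrier

theorem dim_eq_dimH (X : ShiftSpace n) : X.dim = dimH X.metricCarrier := rfl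

/-- The normalisation `n ^ (-p d) = exp (-2 p h)` for `d = 2 h / log n`. -/
theorem inv_pow_rpow_eq_exp (hn : 2 ≤ n) (h : ℝ) (p : ℕ) :
    (((n : ℝ)⁻¹) ^ p) ^ (2 * h / Real.log n) = Real.exp (-(h * (2 * p))) := by
  have hn1 : (1 : ℝ) < n := by exact_mod_cast (by omega : 1 < n)
  have hlog := Real.log_pos hn1
  rw [Real.rpow_def_of_pos (by positivity), Real.log_pow, Real.log_inv]
  congr 1
  field_simp

/-! ### Upper and lower bounds for the dimension. -/

namespace HasBoundedGaps

/-- Cover by the central cylinders of length `2 p`: at most a constant times `exp (2 p h)` sets of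
diameter at most `4 n ^ (-p)`, so the sums of `d`-th powers stay bounded. -/
theorem dim_le (hX : X.HasBoundedGaps N) (hn : 2 ≤ n) :
    X.dim ≤ ENNReal.ofReal (2 * X.entropy / Real.log n) := by
  classical
  have hn1 : (1 : ℝ) < n := by exact_mod_cast (by omega : 1 < n)
  have hlog := Real.log_pos hn1
  have hh := hX.entropy_nonneg
  have hd : 0 ≤ 2 * X.entropy / Real.log n := by positivity
  set d := 2 * X.entropy / Real.log n with hddef
  rw [dim_eq_dimH]
  let t : ∀ p : ℕ, X.words (2 * p) → Set (MetricShift n) := fun p w =>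
    {y | ∀ l : Fin (2 * p), y ((l : ℕ) - p) = w.1 l}
  have hdiam : ∀ p w, Metric.ediam (t p w) ≤ ENNReal.ofReal (4 * ((n : ℝ)⁻¹) ^ p) := by
    intro p w
    refine Metric.ediam_le fun y hy z hz => MetricShift.edist_le hn fun i h1 h2 => ?_
    have hy' := hy ⟨(i + p).toNat, by omega⟩
    have hz' := hz ⟨(i + p).toNat, by omega⟩
    simp only [Int.toNat_of_nonneg (by omega : 0 ≤ i + p), add_sub_cancel_right] at hy' hz'
    rw [hy', hz']
  have hcover : ∀ p, X.metricCarrier ⊆ ⋃ w, t p w := by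
    intro p y hy
    refine Set.mem_iUnion.2 ⟨⟨_, hX.headWord_mem (2 * p) (hX.translate (-p) ⟨y, hy⟩)⟩,
      fun l => ?_⟩
    simp [headWord, sub_eq_add_neg]
  have hr : Tendsto (fun p : ℕ => ENNReal.ofReal (4 * ((n : ℝ)⁻¹) ^ p)) atTop (𝓝 0) := by
    have := (tendsto_pow_atTop_nhds_zero_of_lt_one (r := (n : ℝ)⁻¹) (by positivity)
      (inv_lt_one_of_one_lt₀ hn1)).const_mul 4
    simpa using ENNReal.tendsto_ofReal this
  have hbound : ∀ p : ℕ, ∑ w, Metric.ediam (t p w) ^ d ≤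
      ENNReal.ofReal (gapConst n N * 4 ^ d) := by
    intro p
    calc ∑ w, Metric.ediam (t p w) ^ d
        ≤ ∑ _w : X.words (2 * p), ENNReal.ofReal (4 ^ d * Real.exp (-(X.entropy * (2 * p)))) := by
          refine Finset.sum_le_sum fun w _ => ?_
          refine (ENNReal.rpow_le_rpow (hdiam p w) hd).trans (le_of_eq ?_)
          rw [ENNReal.ofReal_rpow_of_nonneg (by positivity) hd,
            Real.mul_rpow (by norm_num) (by positivity), hddef, inv_pow_rpow_eq_exp hn]
      _ = ENNReal.ofReal ((X.words (2 * p)).ncard *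
          (4 ^ d * Real.exp (-(X.entropy * (2 * p))))) := by
          rw [Finset.sum_const, Finset.card_univ, nsmul_eq_mul,
            ENNReal.ofReal_mul (Nat.cast_nonneg _), ENNReal.ofReal_natCast,
            ← Nat.card_coe_set_eq, Nat.card_eq_fintype_card]
      _ ≤ _ := by
          refine ENNReal.ofReal_le_ofReal ?_
          have h1 := hX.ncard_words_le_exp (2 * p)
          push_cast at h1
          calc ((X.words (2 * p)).ncard : ℝ) * (4 ^ d * Real.exp (-(X.entropy * (2 * p))))
              ≤ (gapConst n N * Real.exp (X.entropy * (2 * p))) *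
                (4 ^ d * Real.exp (-(X.entropy * (2 * p)))) := by gcongr
            _ = gapConst n N * 4 ^ d *
                (Real.exp (X.entropy * (2 * p)) * Real.exp (-(X.entropy * (2 * p)))) := by ring
            _ = _ := by rw [← Real.exp_add]; simp
  have hH := Measure.hausdorffMeasure_le_liminf_sum d
    X.metricCarrier (l := atTop) _ hr t
    (Eventually.of_forall hdiam) (Eventually.of_forall hcover)
  have hfin : Measure.hausdorffMeasure d X.metricCarrier ≠ ⊤ := by
    refine ne_top_of_le_ne_top
      (ENNReal.ofReal_ne_top (r := gapConst n N * 4 ^ d)) (hH.trans ?_)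
    exact (liminf_le_liminf (Eventually.of_forall hbound)).trans (liminf_const _).le
  have h := dimH_le_of_hausdorffMeasure_ne_top (d := d.toNNReal)
    (by rwa [Real.coe_toNNReal d hd])
  exact h

theorem measure_thickening_singleton_le {ν : ProbabilityMeasure X.Pt} {c C : ℝ}
    (hX : X.HasBoundedGaps N) (hν : X.IsGibbs ν c C) (p : ℕ) (x : X.Pt) :
    (ν : Measure X.Pt).real (X.thickening p {x}) ≤ C * Real.exp (-(X.entropy * (2 * p))) := by
  rw [← measure_centralWords hν.measurePreserving, ← preimage_iterate_thickening]
  have h := hν.measure_le (2 * p) (hX.translate (-p) x)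
  push_cast at h
  refine le_trans (measureReal_mono ?_) h
  rintro y ⟨_, rfl, hy⟩
  rw [mem_cylinder_headWord]
  intro i h0 hi
  have := hy (i - p) (by omega) (by push_cast at hi; omega)
  rw [shiftMap_iterate_apply] at this
  simpa [sub_eq_add_neg] using this

/-- The mass distribution principle: the Gibbs mass of a small set is at most a constant times its
diameter to the power `d`, so the Hausdorff measure dominates a multiple of the Gibbs measure. -/
theorem le_dim (hX : X.HasBoundedGaps N) (hn : 2 ≤ n) :
    ENNReal.ofReal (2 * X.entropy / Real.log n) ≤ X.dim := by
  have hn1 : (1 : ℝ) < n := by exact_mod_cast (by omega : 1 < n)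
  have hlog := Real.log_pos hn1
  rcases hX.entropy_nonneg.eq_or_lt with hh | hh
  · simp [← hh]
  have hd : 0 < 2 * X.entropy / Real.log n := by positivity
  set d := 2 * X.entropy / Real.log n with hddef
  obtain ⟨ν, c, C, hν⟩ := hX.exists_isGibbs
  have hC : 0 < C := hν.const_pos hX
  let ι : X.Pt → MetricShift n := fun x => x.1
  have hι : Measurable ι := ((MetricShift.continuous_of hn).comp continuous_subtype_val).measurable
  set μ : Measure (MetricShift n) := (ν : Measure X.Pt).map ι with hμ
  have hcyl : ∀ (s : Set (MetricShift n)) (p : ℕ),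
      Metric.ediam s < ENNReal.ofReal (((n : ℝ)⁻¹) ^ (p + 1)) →
      μ s ≤ ENNReal.ofReal (C * Real.exp (-(X.entropy * (2 * p)))) := by
    intro s p hs
    rcases s.eq_empty_or_nonempty with rfl | ⟨x, hx⟩
    · simp
    have hsub : s ⊆ {y : MetricShift n | ∀ i : ℤ, -p ≤ i → i < p → y i = x i} :=
      fun y hy i h1 h2 =>
        MetricShift.eq_of_edist_lt ((Metric.edist_le_ediam_of_mem hy hx).trans_lt hs) h1 h2
    refine (measure_mono hsub).trans ?_
    rw [hμ, Measure.map_apply hι (MetricShift.isOpen_centralCylinder x p).measurableSet]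
    rcases (ι ⁻¹' {y : MetricShift n | ∀ i : ℤ, -p ≤ i → i < p → y i = x i}).eq_empty_or_nonempty
      with he | ⟨z, hz⟩
    · simp [he]
    · rw [← ENNReal.ofReal_toReal (measure_ne_top (ν : Measure X.Pt) _)]
      refine ENNReal.ofReal_le_ofReal ?_
      refine le_trans (measureReal_mono ?_) (hX.measure_thickening_singleton_le hν p z)
      exact fun y hy => ⟨z, rfl, fun i h1 h2 => (hy i h1 h2).trans (hz i h1 h2).symm⟩
  -- A diameter in `(n ^ (-(p + 3)), n ^ (-(p + 2))]` forces agreement on the window `[-p, p)`.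
  -- Passing from `p` to `p + 3` loses `6` coordinates.
  set M := C * Real.exp (X.entropy * 6) with hM
  have hM0 : 0 < M := by positivity
  have hmass : ∀ s : Set (MetricShift n),
      Metric.ediam s ≤ ENNReal.ofReal (((n : ℝ)⁻¹) ^ 2) →
      μ s ≤ ENNReal.ofReal M * Metric.ediam s ^ d := by
    intro s hs
    rcases eq_or_ne (Metric.ediam s) 0 with h0 | h0
    · have hlim : Tendsto (fun p : ℕ => ENNReal.ofReal (C * Real.exp (-(X.entropy * (2 * p)))))
          atTop (𝓝 0) := by
        have h1 : Tendsto (fun p : ℕ => X.entropy * (2 * (p : ℝ))) atTop atTop :=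
          (tendsto_natCast_atTop_atTop.const_mul_atTop (by norm_num)).const_mul_atTop hh
        have h2 := (Real.tendsto_exp_neg_atTop_nhds_zero.comp h1).const_mul C
        simpa using ENNReal.tendsto_ofReal h2
      have : μ s ≤ 0 := ge_of_tendsto' hlim fun p => hcyl s p (by
        rw [h0]
        exact ENNReal.ofReal_pos.2 (by positivity))
      exact this.trans zero_le
    · have htop : Metric.ediam s ≠ ⊤ := ne_top_of_le_ne_top ENNReal.ofReal_ne_top hs
      set D := (Metric.ediam s).toReal with hD
      have hDe : Metric.ediam s = ENNReal.ofReal D := (ENNReal.ofReal_toReal htop).symm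
      have hD0 : 0 < D := ENNReal.toReal_pos h0 htop
      have hinv1 : (n : ℝ)⁻¹ < 1 := inv_lt_one_of_one_lt₀ hn1
      have hinv0 : 0 < (n : ℝ)⁻¹ := by positivity
      have hD2 : D ≤ ((n : ℝ)⁻¹) ^ 2 := by
        rw [hDe] at hs
        exact (ENNReal.ofReal_le_ofReal_iff (by positivity)).1 hs
      obtain ⟨q, hq1, hq2⟩ := exists_nat_pow_near_of_lt_one hD0
        (hD2.trans (pow_le_one₀ hinv0.le hinv1.le)) hinv0 hinv1
      have hq : 2 ≤ q := by
        have := (pow_lt_pow_iff_right_of_lt_one₀ hinv0 hinv1).1 (hq1.trans_le hD2)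
        omega
      obtain ⟨p, rfl⟩ := Nat.exists_eq_add_of_le hq
      have h1 := hcyl s p (by
        rw [hDe, ENNReal.ofReal_lt_ofReal_iff (by positivity)]
        exact hq2.trans_lt ((pow_lt_pow_iff_right_of_lt_one₀ hinv0 hinv1).2 (by omega)))
      refine h1.trans ?_
      rw [hDe, ENNReal.ofReal_rpow_of_pos hD0, ← ENNReal.ofReal_mul hM0.le]
      refine ENNReal.ofReal_le_ofReal ?_
      have h2 : Real.exp (-(X.entropy * (2 * (2 + p + 1 : ℕ)))) ≤ D ^ d := by
        rw [← inv_pow_rpow_eq_exp hn, ← hddef]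
        exact Real.rpow_le_rpow (by positivity) hq1.le hd.le
      calc C * Real.exp (-(X.entropy * (2 * p)))
          = M * Real.exp (-(X.entropy * (2 * (2 + p + 1 : ℕ)))) := by
            rw [hM, mul_assoc, ← Real.exp_add]
            congr 2
            push_cast
            ring
        _ ≤ M * D ^ d := by gcongr
  have hle : (ENNReal.ofReal M)⁻¹ • μ ≤ Measure.hausdorffMeasure d := by
    refine Measure.le_hausdorffMeasure d _ (ENNReal.ofReal (((n : ℝ)⁻¹) ^ 2))
      (ENNReal.ofReal_pos.2 (by positivity)) fun s hs => ?_
    rw [Measure.smul_apply, smul_eq_mul]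
    have hM1 : ENNReal.ofReal M ≠ 0 := (ENNReal.ofReal_pos.2 hM0).ne'
    calc (ENNReal.ofReal M)⁻¹ * μ s
        ≤ (ENNReal.ofReal M)⁻¹ * (ENNReal.ofReal M * Metric.ediam s ^ d) := by
          gcongr
          exact hmass s hs
      _ = _ := by rw [← mul_assoc, ENNReal.inv_mul_cancel hM1 ENNReal.ofReal_ne_top, one_mul]
  have hpos : Measure.hausdorffMeasure d X.metricCarrier ≠ 0 := by
    have h1 : (1 : ENNReal) ≤ μ X.metricCarrier := by
      refine le_trans ?_ (Measure.le_map_apply hι.aemeasurable _)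
      have : ι ⁻¹' X.metricCarrier = Set.univ :=
        Set.eq_univ_of_forall fun x => x.2
      rw [this, measure_univ]
    refine ne_of_gt (lt_of_lt_of_le ?_ (hle _))
    rw [Measure.smul_apply, smul_eq_mul]
    exact ENNReal.mul_pos (ENNReal.inv_ne_zero.2 ENNReal.ofReal_ne_top)
      (zero_lt_one.trans_le h1).ne'
  rw [dim_eq_dimH]
  exact le_dimH_of_hausdorffMeasure_ne_zero (d := d.toNNReal)
    (by rwa [Real.coe_toNNReal d hd.le])

theorem dim_eq (hX : X.HasBoundedGaps N) :
    X.dim = ENNReal.ofReal (2 * X.entropy / Real.log n) := by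
  rcases Nat.lt_or_ge n 2 with hn | hn
  -- With one symbol the space is a point, and the right side is `0` because division by `log 1 = 0`
  -- gives `0`.
  · obtain rfl : n = 1 := by
      have := hX.alphabet_pos
      omega
    rw [dim_eq_dimH, dimH_subsingleton]
    · simp
    · exact fun x _ y _ => funext fun i => Subsingleton.elim (α := Fin 1) _ _
  · exact le_antisymm (hX.dim_le hn) (hX.le_dim hn)

end HasBoundedGaps

end ShiftSpace

/-! ### Factor maps -/

namespace FactorMap

open ShiftSpace

variable {m n N : ℕ} {X : ShiftSpace m} {Y : ShiftSpace n}

theorem iterate_apply (f : FactorMap X Y) (x : X.Pt) (t : ℕ) (i : ℤ) :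
    (f.toFun (X.shiftMap^[t] x)).1 i = (f.toFun x).1 (i + t) := by
  rw [(f.semiconj.iterate_right t).eq, shiftMap_iterate_apply]

theorem translate_apply (f : FactorMap X Y) (hX : X.HasBoundedGaps N) (t : ℤ) (x : X.Pt) (i : ℤ) :
    (f.toFun (hX.translate t x)).1 i = (f.toFun x).1 (i + t) := by
  obtain ⟨s, rfl | rfl⟩ := t.eq_nat_or_neg
  · have : hX.translate s x = X.shiftMap^[s] x :=
      Subtype.ext (funext fun i => by rw [shiftMap_iterate_apply, HasBoundedGaps.translate_apply])
    rw [this, iterate_apply]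
  · have : x = X.shiftMap^[s] (hX.translate (-s) x) :=
      Subtype.ext (funext fun i => by rw [shiftMap_iterate_apply]; simp)
    conv_rhs => rw [this, iterate_apply]
    simp

/-- The image of a point at a coordinate depends only on finitely many neighbouring coordinates. -/
theorem exists_radius (f : FactorMap X Y) (hX : X.HasBoundedGaps N) : ∃ r : ℕ, ∀ (i : ℤ) (x y : X.Pt),
    (∀ j, i - r ≤ j → j ≤ i + r → x.1 j = y.1 j) → (f.toFun x).1 i = (f.toFun y).1 i := by
  have key : ∃ r : ℕ, ∀ x y : X.Pt,
      (∀ j : ℤ, -r ≤ j → j ≤ r → x.1 j = y.1 j) → (f.toFun x).1 0 = (f.toFun y).1 0 := by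
    by_contra! hcon
    -- Counterexamples for growing radii have a common limit along an ultrafilter, where continuity
    -- forces equal images.
    choose x y hxy hne using hcon
    have := hX.compactSpace
    have hU : (hyperfilter ℕ : Filter ℕ) ≤ atTop := Nat.hyperfilter_le_atTop
    set U := hyperfilter ℕ
    obtain ⟨a, ha⟩ : ∃ a, Tendsto x U (𝓝 a) := ⟨_, (U.map x).le_nhds_lim⟩
    have hb : Tendsto y U (𝓝 a) := by
      refine tendsto_subtype_rng.2 (tendsto_pi_nhds.2 fun i => ?_)
      refine (tendsto_pi_nhds.1 (tendsto_subtype_rng.1 ha) i).congr' ?_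
      filter_upwards [hU (eventually_gt_atTop i.natAbs)] with r hr
      have hr' : i.natAbs < r := hr
      exact hxy r i (by omega) (by omega)
    have hc : Continuous fun z : X.Pt => (f.toFun z).1 0 :=
      (continuous_apply 0).comp (continuous_subtype_val.comp f.continuous_toFun)
    have hd : ∀ᶠ b in 𝓝 ((f.toFun a).1 0), b = (f.toFun a).1 0 := by
      rw [nhds_discrete]
      exact eventually_pure.2 rfl
    have h1 := ((hc.tendsto a).comp ha).eventually hd
    have h2 := ((hc.tendsto a).comp hb).eventually hd
    obtain ⟨r, h1, h2⟩ := (h1.and h2).exists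
    exact hne r (h1.trans h2.symm)
  obtain ⟨r, hr⟩ := key
  refine ⟨r, fun i x y h => ?_⟩
  have h1 := hr (hX.translate i x) (hX.translate i y) fun j h1 h2 => by
    rw [HasBoundedGaps.translate_apply, HasBoundedGaps.translate_apply]
    exact h _ (by linarith) (by linarith)
  rw [translate_apply, translate_apply] at h1
  simpa using h1

/-- Glue preimages, keeping `r` extra coordinates on each side of the gap because the image sees `r`
coordinates away; the gap grows by `2 r`. -/
theorem hasBoundedGaps (f : FactorMap X Y) (hX : X.HasBoundedGaps N) :
    ∃ M, Y.HasBoundedGaps M := by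
  obtain ⟨r, hr⟩ := f.exists_radius hX
  have hsurj : ∀ y ∈ Y.carrier, ∃ x, (f.toFun x).1 = y := fun y hy => by
    obtain ⟨x, hx⟩ := f.surjective_toFun ⟨y, hy⟩
    exact ⟨x, congrArg Subtype.val hx⟩
  refine ⟨N + 2 * r, ?_, ?_, ?_, ?_⟩
  · have := hX.compactSpace
    have h : Y.carrier = Set.range fun x => (f.toFun x).1 :=
      Set.Subset.antisymm hsurj (by rintro _ ⟨x, rfl⟩; exact (f.toFun x).2)
    rw [h]
    exact (isCompact_range (continuous_subtype_val.comp f.continuous_toFun)).isClosed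
  · obtain ⟨x⟩ := hX.nonempty_pt
    exact ⟨_, (f.toFun x).2⟩
  · intro y hy t
    obtain ⟨x, rfl⟩ := hsurj y hy
    have : (fun i => (f.toFun x).1 (i + t)) = (f.toFun (hX.translate t x)).1 :=
      funext fun i => (f.translate_apply hX t x i).symm
    rw [this]
    exact (f.toFun _).2
  · intro y hy y' hy'
    obtain ⟨x, rfl⟩ := hsurj y hy
    obtain ⟨x', rfl⟩ := hsurj y' hy'
    obtain ⟨g, hg, z, h1, h2⟩ := hX.glue_at x (hX.translate (-r) x') r
    refine ⟨g + 2 * r, by omega, (f.toFun z).1, (f.toFun z).2, fun i hi => ?_, fun i hi => ?_⟩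
    · exact hr i z x fun j _ hj => h1 j (by omega)
    · have h3 := hr (i + (g + 2 * r : ℕ)) z (hX.translate (-(g + 2 * r : ℕ)) x') fun j hj _ => by
        have h4 := h2 (j - r - g) (by push_cast at hj; omega)
        rw [HasBoundedGaps.translate_apply] at h4 ⊢
        rw [show (r : ℤ) + g + (j - r - g) = j by ring] at h4
        rw [h4]
        push_cast
        ring_nf
      rw [h3, translate_apply, add_neg_cancel_right]

/-- An image word of length `k` is determined by a word of length `k + 2 r`. -/
theorem entropy_le (f : FactorMap X Y) (hX : X.HasBoundedGaps N) : Y.entropy ≤ X.entropy := by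
  obtain ⟨r, hr⟩ := f.exists_radius hX
  obtain ⟨M, hY⟩ := f.hasBoundedGaps hX
  have hcard : ∀ k, (Y.words k).ncard ≤ (X.words k).ncard * (X.words (2 * r)).ncard := by
    intro k
    refine le_trans ?_ (hX.ncard_words_add_le k (2 * r))
    choose x hx using fun w : Y.words k => f.surjective_toFun (hY.point w)
    simp only [← Nat.card_coe_set_eq]
    refine Nat.card_le_card_of_injective (fun w : Y.words k =>
      (⟨_, hX.headWord_mem (k + 2 * r) (hX.translate (-r) (x w))⟩ : X.words (k + 2 * r))) ?_
    intro v w h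
    simp only [Subtype.mk.injEq, headWord_eq_iff, HasBoundedGaps.translate_apply] at h
    refine hY.ext_point fun i h0 hi => ?_
    rw [← hx v, ← hx w]
    refine hr i _ _ fun j h1 h2 => ?_
    have := h (j + r) (by omega) (by push_cast; omega)
    simpa using this
  have hlim : Tendsto (fun k : ℕ => Real.log (X.words k).ncard / k +
      Real.log (X.words (2 * r)).ncard / k) atTop (𝓝 (X.entropy + 0)) :=
    hX.tendsto_entropy.add (tendsto_const_div_atTop_nhds_zero_nat _)
  rw [add_zero] at hlim
  refine le_of_tendsto_of_tendsto' hY.tendsto_entropy hlim fun k => ?_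
  have hp : ∀ k, ((X.words k).ncard : ℝ) ≠ 0 := fun k => by
    exact_mod_cast (hX.ncard_words_pos k).ne'
  rw [← add_div, ← Real.log_mul (hp _) (hp _)]
  gcongr
  · exact_mod_cast hY.ncard_words_pos k
  · exact_mod_cast hcard k

theorem measurePreserving_push (f : FactorMap X Y) {μ : ProbabilityMeasure X.Pt}
    (hμ : MeasurePreserving X.shiftMap (μ : Measure X.Pt) (μ : Measure X.Pt)) :
    MeasurePreserving Y.shiftMap (f.push μ : Measure Y.Pt) (f.push μ : Measure Y.Pt) := by
  have hf := f.continuous_toFun.measurable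
  have hY := Y.continuous_shiftMap.measurable
  refine ⟨hY, ?_⟩
  change ((μ : Measure X.Pt).map f.toFun).map Y.shiftMap = (μ : Measure X.Pt).map f.toFun
  rw [Measure.map_map hY hf, ← f.semiconj.comp_eq,
    ← Measure.map_map hf X.continuous_shiftMap.measurable, hμ.map_eq]

/-! ### Finite-to-one factor maps preserve maximal entropy. -/

/-- A shift space is one-step if blocks of points that agree at both ends can be exchanged. -/
def _root_.ShiftSpace.IsOneStep (X : ShiftSpace m) : Prop :=
  ∀ x ∈ X.carrier, ∀ y ∈ X.carrier, ∀ a b : ℤ, x a = y a → x b = y b →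
    (fun i => if a ≤ i ∧ i ≤ b then y i else x i) ∈ X.carrier

/-- A finite-to-one factor map of a one-step shift space has no diamonds: a word of the image and
the ends of a preimage determine the preimage. -/
theorem FiniteToOne.eq_of_map_eq {f : FactorMap X Y} (hf : f.FiniteToOne)
    (hX : X.HasBoundedGaps N) (hstep : X.IsOneStep) {r : ℕ}
    (hr : ∀ (i : ℤ) (x y : X.Pt), (∀ j, i - r ≤ j → j ≤ i + r → x.1 j = y.1 j) →
      (f.toFun x).1 i = (f.toFun y).1 i) {k : ℕ} {x y : X.Pt}
    (hl : ∀ i : ℤ, 0 ≤ i → i ≤ 2 * r → x.1 i = y.1 i)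
    (hrt : ∀ i : ℤ, k - 1 - 2 * r ≤ i → i < k → x.1 i = y.1 i)
    (hfxy : ∀ i : ℤ, 0 ≤ i → i < k → (f.toFun x).1 i = (f.toFun y).1 i) {i : ℤ}
    (h0 : 0 ≤ i) (hi : i < k) : x.1 i = y.1 i := by
  by_contra hne
  have hk : 2 * (r : ℤ) < k := by
    by_contra hk
    exact hne (hl i h0 (by omega))
  obtain ⟨ν, c, C, hν⟩ := hX.exists_isGibbs
  set A := X.cylinder (X.headWord k x) with hA
  have hAm : MeasurableSet A := (X.isClopen_cylinder _).isOpen.measurableSet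
  have hApos : (ν : Measure X.Pt) A ≠ 0 := by
    intro h
    have := (mul_pos hν.pos (Real.exp_pos _)).trans_le (hν.le_measure k x)
    rw [measureReal_def, ← hA, h] at this
    simp at this
  -- The Gibbs measure charges every nonempty cylinder, so by Poincaré recurrence some `z` carries
  -- the block of `x` at infinitely many times.
  have hrec := hν.measurePreserving.conservative.ae_mem_imp_frequently_image_mem
    hAm.nullMeasurableSet
  obtain ⟨z, hzA, hz⟩ := ((frequently_ae_mem_iff.2 hApos).and_eventually hrec).exists
  have hinf : {t : ℕ | X.shiftMap^[t] z ∈ A}.Infinite :=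
    Nat.frequently_atTop_iff_infinite.1 (hz hzA)
  have hzx : ∀ t : ℕ, X.shiftMap^[t] z ∈ A → ∀ j : ℤ, t ≤ j → j < t + k →
      z.1 j = x.1 (j - t) := by
    intro t ht j h1 h2
    rw [hA, mem_cylinder_headWord] at ht
    have := ht (j - t) (by omega) (by omega)
    rw [shiftMap_iterate_apply] at this
    simpa using this
  -- At a visit time `t`, the block of `x` in `z` is replaced by that of `y`.
  let F : ℕ → ℤ → Fin m := fun t j =>
    if (t : ℤ) ≤ j ∧ j ≤ t + k - 1 then (hX.translate (-t) y).1 j else z.1 j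
  have hFmem : ∀ t : ℕ, X.shiftMap^[t] z ∈ A → F t ∈ X.carrier := by
    intro t ht
    refine hstep z.1 z.2 _ (hX.translate (-t) y).2 t (t + k - 1) ?_ ?_
    · rw [hzx t ht t le_rfl (by omega), HasBoundedGaps.translate_apply]
      simpa using hl 0 le_rfl (by positivity)
    · rw [hzx t ht _ (by omega) (by omega), HasBoundedGaps.translate_apply, ← sub_eq_add_neg]
      exact hrt _ (by omega) (by omega)
  -- Near the ends of the block and outside it, the window of radius `r` sees the same symbols in `F
  -- t` and `z`. In the interior it sees only `y`, respectively `x`, whose images agree.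
  have hFz : ∀ (t : ℕ) (ht : X.shiftMap^[t] z ∈ A), f.toFun ⟨F t, hFmem t ht⟩ = f.toFun z := by
    intro t ht
    have hagree : ∀ j : ℤ, j ≤ t + 2 * r ∨ t + k - 1 - 2 * r ≤ j → F t j = z.1 j := by
      intro j hj
      by_cases hin : (t : ℤ) ≤ j ∧ j ≤ t + k - 1
      · simp only [F, hin, and_self, if_true, HasBoundedGaps.translate_apply]
        rw [hzx t ht j hin.1 (by omega), ← sub_eq_add_neg]
        rcases hj with hj | hj
        · exact (hl _ (by omega) (by omega)).symm
        · exact (hrt _ (by omega) (by omega)).symm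
      · simp only [F, hin, if_false]
    refine Subtype.ext (funext fun j => ?_)
    rcases le_or_gt j (t + r) with hj1 | hj1
    · exact hr j _ _ fun l _ h2 => hagree l (Or.inl (by omega))
    rcases le_or_gt (t + k - 1 - r : ℤ) j with hj2 | hj2
    · exact hr j _ _ fun l h1 _ => hagree l (Or.inr (by omega))
    have e1 : (f.toFun ⟨F t, hFmem t ht⟩).1 j = (f.toFun (hX.translate (-t) y)).1 j := by
      refine hr j _ _ fun l h1 h2 => ?_
      have hin : (t : ℤ) ≤ l ∧ l ≤ t + k - 1 := ⟨by omega, by omega⟩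
      simp only [F, hin, and_self, if_true]
    have e2 : (f.toFun z).1 j = (f.toFun (hX.translate (-t) x)).1 j := by
      refine hr j _ _ fun l h1 h2 => ?_
      rw [hzx t ht l (by omega) (by omega), HasBoundedGaps.translate_apply, ← sub_eq_add_neg]
    rw [e1, e2, translate_apply, translate_apply, ← sub_eq_add_neg]
    exact (hfxy _ (by omega) (by omega)).symm
  refine hinf (((hf (f.toFun z)).biUnion (t := fun v => {t : ℕ | X.shiftMap^[t] z ∈ A ∧ F t = v.1})
    fun v _ => ?_).subset fun t ht => ?_)
  · rcases Set.eq_empty_or_nonempty {t : ℕ | X.shiftMap^[t] z ∈ A ∧ F t = v.1} with he | ⟨s, hs⟩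
    · rw [he]
      exact Set.finite_empty
    -- If `t ≥ s + k`, then `F s` still carries the block of `x` at `t` where `F t` carries that of
    -- `y`, so they differ at `t + i`. Each point of the finite fibre thus accounts for finitely
    -- many times.
    · refine (Set.finite_Iio (s + k)).subset fun t ht => ?_
      by_contra hts
      rw [Set.mem_Iio, not_lt] at hts
      have h1 : F t (t + i) = y.1 i := by
        have hin : (t : ℤ) ≤ t + i ∧ (t : ℤ) + i ≤ t + k - 1 := ⟨by omega, by omega⟩
        simp only [F, hin, and_self, if_true, HasBoundedGaps.translate_apply]
        ring_nf
      have h2 : F s (t + i) = x.1 i := by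
        have hin : ¬ ((s : ℤ) ≤ t + i ∧ (t : ℤ) + i ≤ s + k - 1) := by omega
        simp only [F, hin, if_false]
        rw [hzx t ht.1 _ (by omega) (by omega)]
        ring_nf
      rw [hs.2] at h2
      rw [ht.2] at h1
      exact hne (h2.symm.trans h1)
  · exact Set.mem_biUnion (x := (⟨F t, hFmem t ht⟩ : X.Pt)) (hFz t ht) ⟨ht, rfl⟩

/-- Without diamonds, an image word and the two end blocks of length `2 r + 1` determine the word
above. The lost entropy is at most `log M`, independently of `k`. -/
theorem FiniteToOne.measureEntropy_le {f : FactorMap X Y} (hf : f.FiniteToOne)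
    (hX : X.HasBoundedGaps N) (hstep : X.IsOneStep) {μ : ProbabilityMeasure X.Pt}
    (hμ : MeasurePreserving X.shiftMap (μ : Measure X.Pt) (μ : Measure X.Pt)) :
    X.measureEntropy μ ≤ Y.measureEntropy (f.push μ) := by
  obtain ⟨r, hr⟩ := f.exists_radius hX
  set M := Nat.card ((Fin (2 * r + 1) → Fin m) × (Fin (2 * r + 1) → Fin m))
  have hcard : ∀ k (v : Fin k → Fin n),
      (X.headWord k '' ((fun x => Y.headWord k (f.toFun x)) ⁻¹' {v})).ncard ≤ M := by
    intro k v
    choose x hx using fun u : ↥(X.headWord k '' ((fun x => Y.headWord k (f.toFun x)) ⁻¹' {v})) =>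
      u.2
    rw [← Nat.card_coe_set_eq]
    refine Nat.card_le_card_of_injective (fun u => (X.headWord (2 * r + 1) (x u),
      X.headWord (2 * r + 1) (hX.translate (k - 1 - 2 * r) (x u)))) ?_
    intro u w h
    simp only [Prod.mk.injEq, headWord_eq_iff, HasBoundedGaps.translate_apply] at h
    apply Subtype.ext
    rw [← (hx u).2, ← (hx w).2, headWord_eq_iff]
    intro i h0 hi
    refine hf.eq_of_map_eq hX hstep hr (k := k) (fun j h1 h2 => ?_) (fun j h1 h2 => ?_)
      (headWord_eq_iff.1 ((hx u).1.trans (hx w).1.symm)) h0 hi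
    · exact h.1 j h1 (by push_cast; omega)
    · have := h.2 (j - (k - 1 - 2 * r)) (by omega) (by push_cast; omega)
      simpa using this
  have hent : ∀ k, shannonEntropy (μ : Measure X.Pt) (X.headWord k) ≤
      shannonEntropy (f.push μ : Measure Y.Pt) (Y.headWord k) + Real.log M := by
    intro k
    have hm : ∀ v, MeasurableSet ((fun x => Y.headWord k (f.toFun x)) ⁻¹' {v}) := fun v =>
      f.continuous_toFun.measurable (Y.measurableSet_headWord_fiber k v)
    refine (shannonEntropy_le_add_log (X.measurableSet_headWord_fiber k) hm
      (hcard k)).trans (le_of_eq ?_)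
    congr 1
    unfold shannonEntropy
    refine Finset.sum_congr rfl fun v _ => ?_
    congr 1
    exact congrArg ENNReal.toReal (Measure.map_apply f.continuous_toFun.measurable
      (Y.measurableSet_headWord_fiber k v)).symm
  have hlim : Tendsto (fun k : ℕ => shannonEntropy (f.push μ : Measure Y.Pt) (Y.headWord k) / k +
      Real.log M / k) atTop (𝓝 (Y.measureEntropy (f.push μ) + 0)) :=
    (tendsto_measureEntropy (f.measurePreserving_push hμ)).add
      (tendsto_const_div_atTop_nhds_zero_nat _)
  rw [add_zero] at hlim
  refine le_of_tendsto_of_tendsto' (tendsto_measureEntropy hμ) hlim fun k => ?_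
  rw [← add_div]
  gcongr
  exact hent k

theorem FiniteToOne.push_mem_maxMeasures {f : FactorMap X Y} (hf : f.FiniteToOne)
    (hX : X.HasBoundedGaps N) (hstep : X.IsOneStep) {μ : ProbabilityMeasure X.Pt}
    (hμ : μ ∈ X.maxMeasures) : f.push μ ∈ Y.maxMeasures := by
  obtain ⟨M, hY⟩ := f.hasBoundedGaps hX
  have hinv := f.measurePreserving_push hμ.1
  refine ⟨hinv, le_antisymm (hY.measureEntropy_le hinv) ?_⟩
  calc Y.entropy ≤ X.entropy := f.entropy_le hX
    _ = X.measureEntropy μ := hμ.2.symm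
    _ ≤ _ := hf.measureEntropy_le hX hstep hμ.1

end FactorMap

/-! ### Topological Markov chains -/

section Markov

open ShiftSpace

variable {m : ℕ} {T : Matrix (Fin m) (Fin m) ℝ}

theorem exists_path_of_pow_pos (hT : ∀ a b, T a b = 0 ∨ T a b = 1) (k : ℕ) (a b : Fin m)
    (h : 0 < (T ^ k) a b) :
    ∃ p : ℕ → Fin m, p 0 = a ∧ p k = b ∧ ∀ i < k, T (p i) (p (i + 1)) = 1 := by
  induction k generalizing b with
  | zero =>
    refine ⟨fun _ => a, rfl, ?_, fun i hi => absurd hi (Nat.not_lt_zero i)⟩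
    by_contra hab
    simp [hab] at h
  | succ k ih =>
    rw [pow_succ, Matrix.mul_apply] at h
    obtain ⟨l, -, hl⟩ := Finset.exists_lt_of_sum_lt (s := Finset.univ) (f := fun _ => (0 : ℝ))
      (by simpa using h)
    rcases hT l b with h0 | h1
    · simp [h0] at hl
    rw [h1, mul_one] at hl
    obtain ⟨p, hp0, hpk, hp⟩ := ih l hl
    refine ⟨fun i => if i ≤ k then p i else b, by simpa using hp0, by simp, fun i hi => ?_⟩
    rcases Nat.lt_succ_iff_lt_or_eq.1 hi with hik | rfl
    · simpa [hik.le, hik, Nat.succ_le_iff] using hp i hik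
    · simpa [hpk] using h1

theorem isClosed_markovChain (T : Matrix (Fin m) (Fin m) ℝ) : IsClosed (markovChain T).carrier := by
  have : (markovChain T).carrier =
      ⋂ i : ℤ, (fun x : ℤ → Fin m => (x i, x (i + 1))) ⁻¹' {z | T z.1 z.2 = 1} := by
    ext x
    simp [markovChain]
  rw [this]
  exact isClosed_iInter fun i => (isClosed_discrete _).preimage
    ((continuous_apply i).prodMk (continuous_apply (i + 1)))

theorem isOneStep_markovChain (T : Matrix (Fin m) (Fin m) ℝ) : (markovChain T).IsOneStep := by
  intro x hx y hy a b ha hb i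
  have hx' : T (x i) (x (i + 1)) = 1 := hx i
  have hy' : T (y i) (y (i + 1)) = 1 := hy i
  simp only
  split_ifs with h1 h2 h2
  · exact hy'
  · obtain rfl : i = b := by omega
    rwa [← hb]
  · obtain rfl : i + 1 = a := by omega
    rwa [← ha]
  · exact hx'

/-- A closed path through one state, repeated periodically. -/
theorem markovChain_nonempty (hm : 0 < m) (hT : ∀ a b, T a b = 0 ∨ T a b = 1)
    (hirr : T.IsIrreducible) : (markovChain T).carrier.Nonempty := by
  obtain ⟨k, hk, hpos⟩ := (Matrix.isIrreducible_iff_exists_pow_pos hirr.nonneg).1 hirr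
    (⟨0, hm⟩ : Fin m) ⟨0, hm⟩
  obtain ⟨p, hp0, hpk, hp⟩ := exists_path_of_pow_pos hT k _ _ hpos
  have hk' : (0 : ℤ) < k := by exact_mod_cast hk
  refine ⟨fun i => p (i % k).toNat, fun i => ?_⟩
  change T (p (i % k).toNat) (p ((i + 1) % k).toNat) = 1
  have h1 := Int.emod_nonneg i hk'.ne'
  have h2 := Int.emod_lt_of_pos i hk'
  have h3 := hp (i % k).toNat (by omega)
  have h4 : (i + 1) % k = (i % k + 1) % k := by rw [Int.emod_add_emod]
  rcases lt_or_ge (i % k + 1) k with h | h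
  · rw [Int.emod_eq_of_lt (by omega) h] at h4
    rw [h4, show (i % (k : ℤ) + 1).toNat = (i % (k : ℤ)).toNat + 1 by omega]
    exact h3
  · have h5 : i % k + 1 = k := by omega
    rw [h5, Int.emod_self] at h4
    rw [show (i % (k : ℤ)).toNat + 1 = k by omega, hpk] at h3
    rw [h4, Int.toNat_zero, hp0]
    exact h3

theorem markovChain_hasBoundedGaps (hm : 0 < m) (hT : ∀ a b, T a b = 0 ∨ T a b = 1)
    (hirr : T.IsIrreducible) : ∃ N, (markovChain T).HasBoundedGaps N := by
  choose k hk hpos using (Matrix.isIrreducible_iff_exists_pow_pos hirr.nonneg).1 hirr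
  refine ⟨Finset.univ.sup fun z : Fin m × Fin m => k z.1 z.2, isClosed_markovChain T,
    markovChain_nonempty hm hT hirr, fun x hx t i => ?_, fun x hx y hy => ?_⟩
  · have := hx (i + t)
    rwa [show i + t + 1 = i + 1 + t by ring] at this
  obtain ⟨p, hp0, hpk, hp⟩ := exists_path_of_pow_pos hT _ _ _ (hpos (x (-1)) (y 0))
  set K := k (x (-1)) (y 0) with hK
  have hKpos : 0 < K := hk _ _
  have hKle : K ≤ Finset.univ.sup fun z : Fin m × Fin m => k z.1 z.2 :=
    Finset.le_sup (f := fun z : Fin m × Fin m => k z.1 z.2) (Finset.mem_univ (x (-1), y 0))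
  -- A path of `K` edges from `x (-1)` to `y 0` has `K - 1` interior vertices, and these fill the
  -- gap.
  obtain ⟨g, hg⟩ : ∃ g, K = g + 1 := ⟨K - 1, by omega⟩
  let z : ℤ → Fin m := fun i => if i < 0 then x i else if i < g then p (i + 1).toNat else y (i - g)
  have hzx : ∀ i < 0, z i = x i := fun i hi => by simp [z, hi]
  have hzy : ∀ i : ℤ, (g : ℤ) ≤ i → z i = y (i - g) := fun i hi => by
    simp [z, not_lt.2 hi, not_lt.2 ((Int.natCast_nonneg g).trans hi)]
  have hzp : ∀ i : ℤ, -1 ≤ i → i ≤ g → z i = p (i + 1).toNat := by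
    intro i h1 h2
    rcases h1.eq_or_lt with rfl | h1
    · rw [hzx _ (by norm_num)]
      simpa using hp0.symm
    rcases h2.eq_or_lt with rfl | h2
    · rw [hzy _ le_rfl, sub_self, ← hpk, hg]
      congr 1
    · simp [z, h2, not_lt.2 (by omega : (0 : ℤ) ≤ i)]
  refine ⟨g, by omega, z, fun i => ?_, hzx, fun i hi => ?_⟩
  · rcases lt_or_ge i (-1) with h | h
    · rw [hzx i (by omega), hzx (i + 1) (by omega)]
      exact hx i
    rcases lt_or_ge i g with h' | h'
    · rw [hzp i h (by omega), hzp (i + 1) (by omega) (by omega),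
        show (i + 1 + 1).toNat = (i + 1).toNat + 1 by omega]
      exact hp _ (by omega)
    · rw [hzy i h', hzy (i + 1) (by omega), show i + 1 - (g : ℤ) = i - g + 1 by ring]
      exact hy _
  · rw [hzy _ (by omega)]
    simp

end Markov

/-! ### The dimension formula -/

namespace ShiftSpace.HasBoundedGaps

variable {m n M N : ℕ} {X : ShiftSpace m} {Y : ShiftSpace n}

/-- The dimension formula holds with `κ = 2`, and only for this value if the entropy is positive. -/
theorem dimFormula_of_dimFormula (hX : X.HasBoundedGaps N) (hY : Y.HasBoundedGaps M)
    (hle : Y.entropy ≤ X.entropy) {μ : ProbabilityMeasure X.Pt} (hμ : μ ∈ X.maxMeasures)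
    {ν : ProbabilityMeasure Y.Pt} (hν : ν ∈ Y.maxMeasures) {κ : ℝ} (hκ : 0 < κ)
    (h : X.DimFormula κ μ) : Y.DimFormula κ ν := by
  rw [DimFormula, hX.dim_eq, hμ.2] at h
  rw [DimFormula, hY.dim_eq, hν.2]
  rcases hX.entropy_nonneg.eq_or_lt with h0 | h0
  · have : Y.entropy = 0 := le_antisymm (hle.trans h0.ge) hY.entropy_nonneg
    simp [this]
  -- Positive entropy forces a positive denominator, so the formula can be cancelled down to `κ =
  -- 2`.
  · have hlog : 0 < Real.log m := h0.trans_le hX.entropy_le_log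
    rw [ENNReal.ofReal_eq_ofReal_iff (by positivity) (by positivity),
      div_left_inj' hlog.ne', mul_left_inj' h0.ne'] at h
    rw [h]

theorem exists_maxMeasures_eq (hX : X.HasBoundedGaps N) : ∃ ν, X.maxMeasures = {ν} := by
  obtain ⟨ν, c, C, hν⟩ := hX.exists_isGibbs
  exact ⟨ν, hν.maxMeasures_eq hX⟩

end ShiftSpace.HasBoundedGaps

theorem mainTheorem2 (d : ℕ) (B : Set (Fin 2 → Fin (2 * d + 1) → Fin 2))
    (m : Fin 2 → ℕ) (hm : ∀ l, 0 < m l)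
    (T : ∀ l, Matrix (Fin (m l)) (Fin (m l)) ℝ)
    (hT : ∀ l a b, T l a b = 0 ∨ T l a b = 1)
    (hirr : ∀ l, (T l).IsIrreducible)
    (φ : ∀ l, FactorMap (markovChain (T l)) (layerSpace d B l))
    (hφ : ∀ l, (φ l).FiniteToOne)
    (hne : (layerSpace d B 0).entropy ≠ (layerSpace d B 1).entropy)
    (i j : Fin 2) (hij : i ≠ j) :
    (∀ π : FactorMap (markovChain (T i)) (markovChain (T j)), π.IsUniform →
      ∀ μ ∈ (markovChain (T i)).maxMeasures, ∀ μ' ∈ (markovChain (T j)).maxMeasures,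
      ∀ κ : ℝ, 0 < κ → (markovChain (T i)).DimFormula κ μ →
        (markovChain (T j)).DimFormula κ μ' ∧ (markovChain (T j)).DimFormula κ (π.push μ)) ∧
    ((layerSpace d B j).entropy < (layerSpace d B i).entropy →
      (φ i).HasSynchronizingWord →
      ∃ πbar : (layerSpace d B i).maxMeasures → (layerSpace d B j).maxMeasures,
        Continuous πbar ∧ Function.Surjective πbar ∧
        (∀ π : FactorMap (markovChain (T i)) (markovChain (T j)), π.IsUniform →
          ∀ μ ∈ (markovChain (T i)).maxMeasures,
          ∃ h : (φ i).push μ ∈ (layerSpace d B i).maxMeasures,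
            (πbar ⟨(φ i).push μ, h⟩).1 = (φ j).push (π.push μ)) ∧
        ∀ (ν : (layerSpace d B i).maxMeasures) (κ : ℝ), 0 < κ →
          (layerSpace d B i).DimFormula κ ν.1 →
          (layerSpace d B j).DimFormula κ (πbar ν).1) := by
  choose N hW using fun l => markovChain_hasBoundedGaps (hm l) (hT l) (hirr l)
  choose M hY using fun l => (φ l).hasBoundedGaps (hW l)
  have hstep := fun l => isOneStep_markovChain (T l)
  refine ⟨fun π hπ μ hμ μ' hμ' κ hκ h => ?_, fun hlt _ => ?_⟩
  · have hle := π.entropy_le (hW i)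
    exact ⟨(hW i).dimFormula_of_dimFormula (hW j) hle hμ hμ' hκ h,
      (hW i).dimFormula_of_dimFormula (hW j) hle hμ (hπ μ hμ) hκ h⟩
  · obtain ⟨ν₁, hν₁⟩ := (hY i).exists_maxMeasures_eq
    obtain ⟨ν₂, hν₂⟩ := (hY j).exists_maxMeasures_eq
    have hmem₁ : ν₁ ∈ (layerSpace d B i).maxMeasures := hν₁ ▸ rfl
    have hmem₂ : ν₂ ∈ (layerSpace d B j).maxMeasures := hν₂ ▸ rfl
    have huniq : ∀ ν ∈ (layerSpace d B j).maxMeasures, ν₂ = ν := fun ν hν => by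
      rw [hν₂] at hν
      exact hν.symm
    -- Both sets of maximal measures are singletons, so the constant map is the only candidate.
    refine ⟨fun _ => ⟨ν₂, hmem₂⟩, continuous_const, fun ν => ⟨⟨ν₁, hmem₁⟩, ?_⟩, ?_, ?_⟩
    · exact Subtype.ext (huniq ν.1 ν.2)
    · intro π hπ μ hμ
      exact ⟨(hφ i).push_mem_maxMeasures (hW i) (hstep i) hμ,
        huniq _ ((hφ j).push_mem_maxMeasures (hW j) (hstep j) (hπ μ hμ))⟩
    · intro ν κ hκ h
      exact (hY i).dimFormula_of_dimFormula (hY j) hlt.le ν.2 hmem₂ hκ h
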